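/- Let $h$ be a homogeneous cubic polynomial on $\mathbb{R}^3$ (coordinates $x,y,z$). For $p\in\{h=1\}$ let $g_p$ be the restriction of the symmetric bilinear form $-\partial^2h(p)$ (minus the Hessian of $h$ at $p$) to the tangent plane $\ker dh(p)$, and let $$\mathcal{H}(h)=\{p\in\mathbb{R}^3 \mid h(p)=1 \text{ and } g_p \text{ is positive definite}\},$$ a surface with the Riemannian metric $g$. "Component" means connected component of $\mathcal{H}(h)$; a component is called complete if it is a complete Riemannian manifold with the metric $g$, that is, complete for its Riemannian distance, and incomplete otherwise. Two components are called isomorphic if some $\varphi\in \mathrm{GL}(3,\mathbb{R})$ maps one onto the other. 1) For $h=xyz$, $\mathcal{H}(h)=\{h=1\}$ has exactly four components; they are all isomorphic to each other, and each is complete. 2) For $h=x(xy-z^2)$, $\mathcal{H}(h)=\{h=1,\ x>0\}$ is connected and complete. 3) For $h=x(yz+x^2)$, $\mathcal{H}(h)=\{h=1,\ x<1/\sqrt[3]{4}\}$ has exactly four components: a pair of isomorphic complete components and a pair of isomorphic incomplete components. 4) For $h=z(x^2+y^2-z^2)$, $\mathcal{H}(h)=\{h=1,\ z<0\}$ is connected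 and complete. 5) For $h=x(y^2-z^2)+y^3$, $\mathcal{H}(h)=\{h=1,\ y^2-z^2\neq0,\ y(y^2+3z^2)<1\}$ has exactly four components: a complete component, a pair of incomplete components isomorphic to each other, and a further incomplete component. 6) For $h=x(y^2+z^2)+y^3$, $\mathcal{H}(h)=\{h=1,\ y(y^2-3z^2)>1\}$ has exactly three components: a pair of incomplete components isomorphic to each other, and a further incomplete component. 7) For $h=xz^2+y^3$, $\mathcal{H}(h)=\{h=1,\ y<0\}$ has exactly two components; they are isomorphic to each other and incomplete. -/

import Mathlib

open Set Filter Topology MeasureTheory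
open scoped ENNReal

/-- The ambient space `ℝ³`, with coordinates `x = p 0`, `y = p 1`, `z = p 2`. -/
abbrev R3 : Type := Fin 3 → ℝ

/-- The bilinear form `-∂²h(p)` (minus the Hessian of `h` at `p`). -/
noncomputable def negHessian (h : R3 → ℝ) (p v w : R3) : ℝ :=
  -(fderiv ℝ (fderiv ℝ h) p v w)

/-- `𝓗(h)`: the points of the level set `{h = 1}` at which `g_p`, the restriction of `-∂²h(p)`
to the tangent plane `ker dh(p)`, is positive definite. -/
def hyperbolicLocus (h : R3 → ℝ) : Set R3 :=
  {p | h p = 1 ∧ ∀ v : R3, fderiv ℝ h p v = 0 → v ≠ 0 → 0 < negHessian h p v v}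

/-- The set of connected components of a subset of `ℝ³` (in the subspace topology). -/
def componentsOf (S : Set R3) : Set (Set R3) :=
  {C | ∃ p ∈ S, C = connectedComponentIn S p}

/-- Two subsets of `ℝ³` are isomorphic if an element of `GL(3, ℝ)` maps one onto the other. -/
def LinIsomorphic (C D : Set R3) : Prop :=
  ∃ φ : R3 ≃ₗ[ℝ] R3, φ '' C = D

/-- The length of a curve `γ : [0, 1] → ℝ³` with respect to `g = -∂²h`. -/
noncomputable def curveLength (h : R3 → ℝ) (γ : ℝ → R3) : ℝ≥0∞ :=
  ∫⁻ t in Icc (0 : ℝ) 1, ENNReal.ofReal (Real.sqrt (negHessian h (γ t) (deriv γ t) (deriv γ t)))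

/-- The Riemannian distance of `p` and `q` in `C`: the infimum of the lengths of the `C¹` curves
that run inside `C` from `p` to `q`. -/
noncomputable def riemDist (h : R3 → ℝ) (C : Set R3) (p q : R3) : ℝ≥0∞ :=
  ⨅ (γ : ℝ → R3) (_ : ContDiffOn ℝ 1 γ (Icc 0 1) ∧ (∀ t ∈ Icc (0 : ℝ) 1, γ t ∈ C) ∧
    γ 0 = p ∧ γ 1 = q), curveLength h γ

/-- `C`, with the metric `g` induced by `-∂²h`, is a complete Riemannian manifold: every sequence
in `C` that is Cauchy for the Riemannian distance converges to a point of `C`. -/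
def RiemComplete (h : R3 → ℝ) (C : Set R3) : Prop :=
  ∀ u : ℕ → R3, (∀ n, u n ∈ C) →
    (∀ ε : ℝ≥0∞, 0 < ε → ∃ N, ∀ m ≥ N, ∀ n ≥ N, riemDist h C (u m) (u n) < ε) →
    ∃ p ∈ C, Tendsto (fun n => riemDist h C (u n) p) atTop (𝓝 0)

/-- `xyz` -/
def cubic1 (p : R3) : ℝ := p 0 * p 1 * p 2

/-- `x(xy - z²)` -/
def cubic2 (p : R3) : ℝ := p 0 * (p 0 * p 1 - p 2 ^ 2)

/-- `x(yz + x²)` -/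
def cubic3 (p : R3) : ℝ := p 0 * (p 1 * p 2 + p 0 ^ 2)

/-- `z(x² + y² - z²)` -/
def cubic4 (p : R3) : ℝ := p 2 * (p 0 ^ 2 + p 1 ^ 2 - p 2 ^ 2)

/-- `x(y² - z²) + y³` -/
def cubic5 (p : R3) : ℝ := p 0 * (p 1 ^ 2 - p 2 ^ 2) + p 1 ^ 3

/-- `x(y² + z²) + y³` -/
def cubic6 (p : R3) : ℝ := p 0 * (p 1 ^ 2 + p 2 ^ 2) + p 1 ^ 3

/-- `xz² + y³` -/
def cubic7 (p : R3) : ℝ := p 0 * p 2 ^ 2 + p 1 ^ 3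

/-! The locus comes from diagonalising the metric. At a point with h = 1, eliminating variables
through h = 1 and dh(v) = 0 turns -∂²h(v, v) into a combination of squares of linear forms in v
(lemmas `metric_cubic1` to `metric_cubic7`; for the fourth cubic this happens off the axis x = y =
0). The sign of the coefficients is the inequality in the statement, and tangent vectors that
isolate one square show that it is necessary.

The components are the pieces of the locus on which suitable linear forms have fixed signs. Each
piece is the image of a convex set under a continuous parametrisation, except in the fourth case,
where segments in a cone are projected radially onto {h = 1}. Isomorphic pieces are exchanged by
changes of sign of the coordinates.

A complete component has the form {h = 1, l_i > 0 for all i} with linear forms l_i for which |d log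
l_i| ≤ K √g. A Cauchy sequence then keeps every l_i between positive bounds, hence stays in a
compact part of the component. There g is comparable with the ambient norm, so the sequence
converges (`riemComplete_of_linear`).

An incomplete component has a boundary point on {h = 1} that is reached by a C¹ curve running inside
the component. The length of the curve is finite, since g is bounded on its compact image, so its
points form a Cauchy sequence. That sequence has no limit in the component: a bump function around a
supposed limit separates it from the boundary point (`not_riemComplete_of_curve`). -/

/-! ### Comparison of the metric with the ambient norm on compact sets -/

theorem continuous_fderiv_apply {h : R3 → ℝ} (hh : ContDiff ℝ 2 h) :
    Continuous fun x : R3 × R3 => fderiv ℝ h x.1 x.2 :=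
  ((hh.continuous_fderiv (by norm_num)).comp continuous_fst).clm_apply continuous_snd

theorem continuous_fderiv_fderiv {h : R3 → ℝ} (hh : ContDiff ℝ 2 h) :
    Continuous (fderiv ℝ (fderiv ℝ h)) :=
  (hh.fderiv_right (m := 1) (by norm_num)).continuous_fderiv (by norm_num)

theorem continuous_negHessian {h : R3 → ℝ} (hh : ContDiff ℝ 2 h) :
    Continuous fun x : R3 × R3 => negHessian h x.1 x.2 x.2 :=
  ((((continuous_fderiv_fderiv hh).comp continuous_fst).clm_apply
    continuous_snd).clm_apply continuous_snd).neg

theorem negHessian_smul (h : R3 → ℝ) (p v : R3) (c : ℝ) :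
    negHessian h p (c • v) (c • v) = c ^ 2 * negHessian h p v v := by
  simp only [negHessian, map_smul, _root_.smul_apply, smul_eq_mul]; ring

/-- On a compact set the metric is bounded above by the ambient norm. -/
theorem exists_negHessian_le {h : R3 → ℝ} (hh : ContDiff ℝ 2 h) {K : Set R3} (hK : IsCompact K) :
    ∃ A : ℝ, 0 ≤ A ∧ ∀ p ∈ K, ∀ v : R3, negHessian h p v v ≤ (A * ‖v‖) ^ 2 := by
  obtain ⟨B, hB⟩ := hK.exists_bound_of_continuousOn
    (Continuous.norm (E := R3 →L[ℝ] R3 →L[ℝ] ℝ) (continuous_fderiv_fderiv hh)).continuousOn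
  simp only [norm_norm] at hB
  refine ⟨Real.sqrt (max B 0), Real.sqrt_nonneg _, fun p hp v => ?_⟩
  rw [mul_pow, Real.sq_sqrt (le_max_right _ _)]
  calc negHessian h p v v ≤ ‖fderiv ℝ (fderiv ℝ h) p v v‖ := by
        rw [negHessian]; exact neg_le_abs _
    _ ≤ ‖fderiv ℝ (fderiv ℝ h) p‖ * ‖v‖ * ‖v‖ := ContinuousLinearMap.le_opNorm₂ _ _ _
    _ ≤ max B 0 * ‖v‖ * ‖v‖ := by gcongr; exact (hB p hp).trans (le_max_left _ _)
    _ = _ := by ring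

/-- On a compact part of the hyperbolic locus the metric is bounded below by the ambient norm. -/
theorem exists_norm_le_negHessian {h : R3 → ℝ} (hh : ContDiff ℝ 2 h) {K : Set R3}
    (hK : IsCompact K) (hKh : K ⊆ hyperbolicLocus h) :
    ∃ c : ℝ, 0 ≤ c ∧ ∀ p ∈ K, ∀ v : R3, fderiv ℝ h p v = 0 →
      ‖v‖ ≤ c * Real.sqrt (negHessian h p v v) := by
  -- Unit tangent vectors over K form a compact set, on which the metric attains a positive minimum
  -- m; homogeneity in v then gives the constant 1/√m.
  set T : Set (R3 × R3) := (K ×ˢ Metric.sphere 0 1) ∩ {x | fderiv ℝ h x.1 x.2 = 0}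
  have hT : IsCompact T := (hK.prod (isCompact_sphere _ _)).inter_right
    (isClosed_eq (continuous_fderiv_apply hh) continuous_const)
  obtain ⟨m, hm, hmT⟩ : ∃ m : ℝ, 0 < m ∧ ∀ x ∈ T, m ≤ negHessian h x.1 x.2 x.2 := by
    rcases T.eq_empty_or_nonempty with he | hne
    · exact ⟨1, one_pos, by simp [he]⟩
    · obtain ⟨x, hx, hmin⟩ := hT.exists_isMinOn hne (continuous_negHessian hh).continuousOn
      refine ⟨_, (hKh hx.1.1).2 x.2 hx.2 ?_, fun y hy => hmin hy⟩
      rintro h0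
      have := hx.1.2
      simp [h0] at this
  refine ⟨(Real.sqrt m)⁻¹, by positivity, fun p hp v hv => ?_⟩
  rcases eq_or_ne v 0 with rfl | hv0
  · simpa using by positivity
  have hn : 0 < ‖v‖ := norm_pos_iff.2 hv0
  have h1 := hmT (p, ‖v‖⁻¹ • v) ⟨⟨hp, by simp [norm_smul, hn.ne']⟩, by simp [hv]⟩
  simp only [negHessian_smul] at h1
  have h2 : m * ‖v‖ ^ 2 ≤ negHessian h p v v := by
    rw [inv_pow, inv_mul_eq_div, le_div_iff₀ (by positivity)] at h1
    exact h1
  have h3 := Real.sqrt_le_sqrt h2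
  rw [Real.sqrt_mul hm.le, Real.sqrt_sq hn.le] at h3
  rw [inv_mul_eq_div, le_div_iff₀ (Real.sqrt_pos.2 hm)]
  linarith

/-! ### Curves and their lengths -/

/-- The admissible curves in the definition of `riemDist`. -/
def IsCurveFrom (C : Set R3) (γ : ℝ → R3) (p q : R3) : Prop :=
  ContDiffOn ℝ 1 γ (Icc 0 1) ∧ (∀ t ∈ Icc (0 : ℝ) 1, γ t ∈ C) ∧ γ 0 = p ∧ γ 1 = q

theorem riemDist_le {h : R3 → ℝ} {C : Set R3} {γ : ℝ → R3} {p q : R3}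
    (hγ : IsCurveFrom C γ p q) : riemDist h C p q ≤ curveLength h γ :=
  iInf₂_le γ hγ

theorem exists_curve_of_riemDist_lt {h : R3 → ℝ} {C : Set R3} {p q : R3} {r : ℝ≥0∞}
    (H : riemDist h C p q < r) : ∃ γ, IsCurveFrom C γ p q ∧ curveLength h γ < r := by
  simp only [riemDist, iInf_lt_iff] at H
  obtain ⟨γ, hγ, hl⟩ := H
  exact ⟨γ, hγ, hl⟩

theorem IsCurveFrom.hasDerivAt {C : Set R3} {γ : ℝ → R3} {p q : R3} (hγ : IsCurveFrom C γ p q)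
    {t : ℝ} (ht : t ∈ Ioo (0 : ℝ) 1) : HasDerivAt γ (deriv γ t) t :=
  ((hγ.1.differentiableOn one_ne_zero).differentiableAt (Icc_mem_nhds ht.1 ht.2)).hasDerivAt

/-- Velocities of curves in a level set are tangent to it. -/
theorem IsCurveFrom.fderiv_deriv {h : R3 → ℝ} (hh : ContDiff ℝ 2 h) {C : Set R3}
    (hC : ∀ p ∈ C, h p = 1) {γ : ℝ → R3} {p q : R3} (hγ : IsCurveFrom C γ p q)
    {t : ℝ} (ht : t ∈ Ioo (0 : ℝ) 1) : fderiv ℝ h (γ t) (deriv γ t) = 0 := by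
  have h1 : HasDerivAt (h ∘ γ) (fderiv ℝ h (γ t) (deriv γ t)) t :=
    ((hh.differentiable (by norm_num)) (γ t)).hasFDerivAt.comp_hasDerivAt t (hγ.hasDerivAt ht)
  have h2 : HasDerivAt (h ∘ γ) 0 t := by
    refine (hasDerivAt_const t (1 : ℝ)).congr_of_eventuallyEq ?_
    filter_upwards [Icc_mem_nhds ht.1 ht.2] with s hs
    exact hC _ (hγ.2.1 s hs)
  exact h1.unique h2

/-- A function whose differential is dominated by the metric along a curve varies at most by a
multiple of the length of the curve. -/
theorem IsCurveFrom.enorm_sub_le {F : Type*} [NormedAddCommGroup F] [NormedSpace ℝ F]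
    {h : R3 → ℝ} (hh : ContDiff ℝ 2 h) {C : Set R3}
    (hC : ∀ p ∈ C, h p = 1) {γ : ℝ → R3} {p q : R3} (hγ : IsCurveFrom C γ p q)
    {Φ : R3 → F} (hΦ : ∀ p ∈ C, ContDiffAt ℝ 1 Φ p) {κ : ℝ} (hκ : 0 ≤ κ)
    {s : ℝ} (hs : s ∈ Icc (0 : ℝ) 1)
    (hb : ∀ t ∈ Icc (0 : ℝ) s, ∀ v, fderiv ℝ h (γ t) v = 0 →
      ‖fderiv ℝ Φ (γ t) v‖ ≤ κ * Real.sqrt (negHessian h (γ t) v v)) :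
    ‖Φ (γ s) - Φ p‖ₑ ≤ ENNReal.ofReal κ * curveLength h γ := by
  have hsub : Icc 0 s ⊆ Icc (0 : ℝ) 1 := Icc_subset_Icc_right hs.2
  have hd : ContDiffOn ℝ 1 (Φ ∘ γ) (Icc 0 s) := fun t ht =>
    (hΦ _ (hγ.2.1 t (hsub ht))).comp_contDiffWithinAt t ((hγ.1 t (hsub ht)).mono hsub)
  have h1 := enorm_sub_le_lintegral_deriv_of_contDiffOn_Icc hd hs.1
  simp only [Function.comp_apply, hγ.2.2.1] at h1
  refine h1.trans ?_
  rw [curveLength, ← lintegral_const_mul' _ _ ENNReal.ofReal_ne_top]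
  refine le_trans ?_ (lintegral_mono_set hsub)
  refine lintegral_mono_ae ?_
  -- At an endpoint `deriv γ` need not be the one-sided derivative of the curve; the endpoints form
  -- a null set and are dropped.
  rw [← restrict_Ioo_eq_restrict_Icc]
  filter_upwards [self_mem_ae_restrict measurableSet_Ioo] with t ht
  have ht' : t ∈ Ioo (0 : ℝ) 1 := ⟨ht.1, ht.2.trans_le hs.2⟩
  have h3 : deriv (Φ ∘ γ) t = fderiv ℝ Φ (γ t) (deriv γ t) :=
    (((hΦ _ (hγ.2.1 t (hsub (Ioo_subset_Icc_self ht)))).differentiableAt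
      one_ne_zero).hasFDerivAt.comp_hasDerivAt t (hγ.hasDerivAt ht')).deriv
  rw [h3, ← ENNReal.ofReal_mul hκ, ← ofReal_norm]
  exact ENNReal.ofReal_le_ofReal (hb t (Ioo_subset_Icc_self ht) _ (hγ.fderiv_deriv hh hC ht'))

/-- A curve of speed at most `a` with respect to the metric has length at most `a`. -/
theorem curveLength_le {h : R3 → ℝ} {γ : ℝ → R3} {a : ℝ}
    (H : ∀ t ∈ Ioo (0 : ℝ) 1, Real.sqrt (negHessian h (γ t) (deriv γ t) (deriv γ t)) ≤ a) :
    curveLength h γ ≤ ENNReal.ofReal a := by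
  rw [curveLength, ← restrict_Ioo_eq_restrict_Icc]
  calc _ ≤ ∫⁻ t in Ioo (0 : ℝ) 1, ENNReal.ofReal a := by
        refine setLIntegral_mono measurable_const fun t ht => ?_
        exact ENNReal.ofReal_le_ofReal (H t ht)
    _ = _ := by simp

/-! ### Radial retraction and convergence for the Riemannian distance -/

/-- The retraction of `{h > 0}` onto `{h = 1}` along rays. -/
noncomputable def rayProj (h : R3 → ℝ) (p : R3) : R3 := (h p) ^ (-(1 / 3) : ℝ) • p

theorem rayProj_eq_self {h : R3 → ℝ} {p : R3} (hp : h p = 1) : rayProj h p = p := by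
  simp [rayProj, hp]

theorem apply_rayProj {h : R3 → ℝ} (hom : ∀ (t : ℝ) p, h (t • p) = t ^ 3 * h p) {p : R3}
    (hp : 0 < h p) : h (rayProj h p) = 1 := by
  rw [rayProj, hom, ← Real.rpow_natCast, ← Real.rpow_mul hp.le]
  norm_num
  rw [Real.rpow_neg_one, inv_mul_cancel₀ hp.ne']

theorem contDiffAt_rayProj {h : R3 → ℝ} (hh : ContDiff ℝ 2 h) {p : R3} (hp : 0 < h p) :
    ContDiffAt ℝ 1 (rayProj h) p :=
  ((hh.contDiffAt.of_le (by norm_num)).rpow_const_of_ne hp.ne').smul contDiffAt_id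

/-- Convergence in `ℝ³` implies convergence for the Riemannian distance. -/
theorem tendsto_riemDist {h : R3 → ℝ} (hh : ContDiff ℝ 2 h)
    (hom : ∀ (t : ℝ) p, h (t • p) = t ^ 3 * h p) {U : Set R3} (hU : IsOpen U)
    {u : ℕ → R3} (hu : ∀ n, h (u n) = 1) {p : R3} (hp : h p = 1) (hpU : p ∈ U)
    (hlim : Tendsto u atTop (𝓝 p)) :
    Tendsto (fun n => riemDist h ({p | h p = 1} ∩ U) (u n) p) atTop (𝓝 0) := by
  have hp0 : 0 < h p := by rw [hp]; exact one_pos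
  have hcd := contDiffAt_rayProj hh hp0
  obtain ⟨A, hA0, hA⟩ := exists_negHessian_le hh (isCompact_closedBall (rayProj h p) 1)
  set B := ‖fderiv ℝ (rayProj h) p‖ + 1 with hB
  have hcdf : ContinuousAt (fun x => fderiv ℝ (rayProj h) x) p :=
    (hcd.fderiv_right (m := 0) (by norm_num)).continuousAt
  -- Near p the retraction is defined, stays in U and in a compact ball, and has bounded derivative.
  -- So the retracted segment from u n to p is an admissible curve of length O(‖p - u n‖).
  have hev : ∀ᶠ x in 𝓝 p, 0 < h x ∧ rayProj h x ∈ U ∧ rayProj h x ∈ Metric.closedBall (rayProj h p) 1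
      ∧ ‖fderiv ℝ (rayProj h) x‖ ≤ B := by
    refine ((hh.continuous.tendsto p).eventually (lt_mem_nhds hp0)).and
      ((hcd.continuousAt.tendsto.eventually ?_).and
        ((hcd.continuousAt.tendsto.eventually ?_).and ?_))
    · rw [rayProj_eq_self hp]; exact hU.mem_nhds hpU
    · exact Metric.closedBall_mem_nhds _ one_pos
    · refine (hcdf.norm.tendsto.eventually (gt_mem_nhds (lt_add_one _))).mono fun x hx => hx.le
  obtain ⟨r, hr, hball⟩ := Metric.eventually_nhds_iff_ball.1 hev
  have hbound : ∀ᶠ n in atTop, riemDist h ({p | h p = 1} ∩ U) (u n) p ≤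
      ENNReal.ofReal (A * (B * ‖p - u n‖)) := by
    filter_upwards [hlim.eventually (Metric.ball_mem_nhds p hr)] with n hn
    have hseg : ∀ t ∈ Icc (0 : ℝ) 1, AffineMap.lineMap (u n) p t ∈ Metric.ball p r := fun t ht =>
      (convex_ball p r).lineMap_mem hn (Metric.mem_ball_self hr) ht
    have hcurve : IsCurveFrom ({p | h p = 1} ∩ U)
        (fun t => rayProj h (AffineMap.lineMap (u n) p t)) (u n) p := by
      refine ⟨fun t ht => ?_, fun t ht => ?_, ?_, ?_⟩
      · have := contDiffAt_rayProj hh (hball _ (hseg t ht)).1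
        refine this.comp_contDiffWithinAt t (ContDiff.contDiffWithinAt ?_)
        exact ContinuousAffineMap.contDiff (ContinuousAffineMap.lineMap (R := ℝ) _ _)
      · have := hball _ (hseg t ht)
        exact ⟨apply_rayProj hom this.1, this.2.1⟩
      · simp [rayProj_eq_self (hu n)]
      · simp [rayProj_eq_self hp]
    refine (riemDist_le hcurve).trans (curveLength_le fun t ht => ?_)
    have hb := hball _ (hseg t (Ioo_subset_Icc_self ht))
    have hder : deriv (fun t => rayProj h (AffineMap.lineMap (u n) p t)) t =
        fderiv ℝ (rayProj h) (AffineMap.lineMap (u n) p t) (p - u n) :=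
      (((contDiffAt_rayProj hh hb.1).differentiableAt one_ne_zero).hasFDerivAt.comp_hasDerivAt t
        AffineMap.hasDerivAt_lineMap).deriv
    rw [hder]
    refine Real.sqrt_le_iff.2 ⟨by positivity, (hA _ hb.2.2.1 _).trans ?_⟩
    gcongr
    exact (ContinuousLinearMap.le_opNorm _ _).trans (by gcongr; exact hb.2.2.2)
  refine tendsto_of_tendsto_of_tendsto_of_le_of_le' tendsto_const_nhds ?_
    (Eventually.of_forall fun _ => zero_le) hbound
  have : Tendsto (fun n => A * (B * ‖p - u n‖)) atTop (𝓝 (A * (B * ‖p - p‖))) :=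
    ((tendsto_const_nhds.sub hlim).norm.const_mul B).const_mul A
  have := ENNReal.tendsto_ofReal this
  simpa using this

/-! ### Criterion for completeness -/

/-- An open part of `{h = 1}` is complete if it is cut out by finitely many linear forms with
Lipschitz logarithm that together control the ambient norm. -/
theorem riemComplete_of_linear {h : R3 → ℝ} (hh : ContDiff ℝ 2 h)
    (hom : ∀ (t : ℝ) p, h (t • p) = t ^ 3 * h p) {ι : Type*} [Finite ι] (l : ι → R3 →L[ℝ] ℝ)
    {C : Set R3} (hC : C = {p | h p = 1} ∩ {p | ∀ i, 0 < l i p}) (hCh : C ⊆ hyperbolicLocus h)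
    {K : ℝ} (hK : ∀ p ∈ C, ∀ v, fderiv ℝ h p v = 0 → ∀ i,
      (l i v) ^ 2 ≤ K ^ 2 * ((l i p) ^ 2 * negHessian h p v v))
    (hbdd : ∀ M : ℝ, 0 < M → ∃ R : ℝ, ∀ p ∈ C, (∀ i, M⁻¹ ≤ l i p ∧ l i p ≤ M) → ‖p‖ ≤ R) :
    RiemComplete h C := by
  have hC1 : ∀ p ∈ C, h p = 1 := fun p hp => by rw [hC] at hp; exact hp.1
  have hCpos : ∀ p ∈ C, ∀ i, 0 < l i p := fun p hp => by rw [hC] at hp; exact hp.2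
  have hUo : IsOpen {p : R3 | ∀ i, 0 < l i p} := by
    simp only [ofPred_forall]
    exact isOpen_iInter_of_finite fun i => isOpen_lt continuous_const (l i).continuous
  have hcomp : ∀ M : ℝ, 0 < M → IsCompact {p | h p = 1 ∧ ∀ i, M⁻¹ ≤ l i p ∧ l i p ≤ M} := by
    intro M hM
    obtain ⟨R, hR⟩ := hbdd M hM
    refine Metric.isCompact_of_isClosed_isBounded ?_ ?_
    · have : {p | h p = 1 ∧ ∀ i, M⁻¹ ≤ l i p ∧ l i p ≤ M} =
          {p | h p = 1} ∩ ⋂ i, {p | M⁻¹ ≤ l i p} ∩ {p | l i p ≤ M} := by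
        ext p; simp
      rw [this]
      exact (isClosed_eq hh.continuous continuous_const).inter (isClosed_iInter fun i =>
        (isClosed_le continuous_const (l i).continuous).inter
          (isClosed_le (l i).continuous continuous_const))
    · refine (Metric.isBounded_closedBall (x := (0 : R3)) (r := R)).subset fun p hp => ?_
      rw [mem_closedBall_zero_iff]
      refine hR p ?_ hp.2
      rw [hC]
      exact ⟨hp.1, fun i => (inv_pos.2 hM).trans_le (hp.2 i).1⟩
  intro u hu hcau
  -- along a curve of length less than one the logarithms of the forms vary boundedly
  have hlog : ∀ {γ : ℝ → R3} {p q : R3}, IsCurveFrom C γ p q → curveLength h γ < 1 →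
      ∀ t ∈ Icc (0 : ℝ) 1, ∀ i, |Real.log (l i (γ t)) - Real.log (l i p)| ≤ |K| := by
    intro γ p q hγ hlen t ht i
    have h1 := hγ.enorm_sub_le hh hC1 (Φ := fun p => Real.log (l i p))
      (fun p hp => ((l i).contDiff.contDiffAt).log (hCpos p hp i).ne') (abs_nonneg K) ht
      (fun s hs v hv => ?_)
    · have h2 : ‖Real.log (l i (γ t)) - Real.log (l i p)‖ₑ ≤ ENNReal.ofReal |K| :=
        h1.trans (by simpa using mul_le_mul_right hlen.le (ENNReal.ofReal |K|))
      rw [← ofReal_norm, ENNReal.ofReal_le_ofReal_iff (abs_nonneg K)] at h2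
      exact h2
    · have hm := hγ.2.1 s ⟨hs.1, hs.2.trans ht.2⟩
      have hpos := hCpos _ hm i
      have hf : fderiv ℝ (fun p => Real.log (l i p)) (γ s) v = l i v / l i (γ s) := by
        have := ((l i).hasFDerivAt (x := γ s)).log hpos.ne'
        rw [this.fderiv]
        simp [inv_mul_eq_div]
      have h3 := hK _ hm v hv i
      rw [hf, norm_div, Real.norm_eq_abs, Real.norm_eq_abs, abs_of_pos hpos, div_le_iff₀ hpos,
        ← Real.sqrt_sq_eq_abs]
      refine (Real.sqrt_le_sqrt h3).trans_eq ?_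
      rw [Real.sqrt_mul (sq_nonneg _), Real.sqrt_mul (sq_nonneg _), Real.sqrt_sq_eq_abs,
        Real.sqrt_sq hpos.le]
      ring
  obtain ⟨N, hN⟩ := hcau 1 one_pos
  obtain ⟨b, hb⟩ : ∃ b : ℝ, ∀ i, |Real.log (l i (u N))| ≤ b := by
    obtain ⟨b, hb⟩ := (Set.finite_range fun i => |Real.log (l i (u N))|).bddAbove
    exact ⟨b, fun i => hb ⟨i, rfl⟩⟩
  -- One |K| pays for the way from u N to u n, the other for the points of a short curve starting at
  -- u n.
  set M := Real.exp (b + |K| + |K|) with hM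
  have hM0 : 0 < M := Real.exp_pos _
  have hmem : ∀ p ∈ C, (∀ i, |Real.log (l i p)| ≤ b + |K| + |K|) →
      p ∈ {p | h p = 1 ∧ ∀ i, M⁻¹ ≤ l i p ∧ l i p ≤ M} := by
    refine fun p hp hlp => ⟨hC1 p hp, fun i => ?_⟩
    have := abs_le.1 (hlp i)
    rw [hM, ← Real.exp_neg, ← Real.le_log_iff_exp_le (hCpos p hp i),
      ← Real.log_le_iff_le_exp (hCpos p hp i)]
    exact this
  have hKC : {p | h p = 1 ∧ ∀ i, M⁻¹ ≤ l i p ∧ l i p ≤ M} ⊆ C := fun p hp => by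
    rw [hC]; exact ⟨hp.1, fun i => (inv_pos.2 hM0).trans_le (hp.2 i).1⟩
  obtain ⟨c, hc0, hc⟩ := exists_norm_le_negHessian hh (hcomp M hM0) (hKC.trans hCh)
  have hlogN : ∀ n ≥ N, ∀ i, |Real.log (l i (u n))| ≤ b + |K| := by
    intro n hn i
    obtain ⟨γ, hγ, hl⟩ := exists_curve_of_riemDist_lt (hN N le_rfl n hn)
    have := hlog hγ hl 1 (by simp) i
    rw [hγ.2.2.2] at this
    have h1 := hb i
    have h2 := abs_sub_abs_le_abs_sub (Real.log (l i (u n))) (Real.log (l i (u N)))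
    linarith
  have hcauchy : CauchySeq u := by
    rw [EMetric.cauchySeq_iff]
    intro ε hε
    obtain ⟨δ, hδ, hδε⟩ : ∃ δ : ℝ≥0∞, 0 < δ ∧ ENNReal.ofReal c * δ < ε := by
      have : Tendsto (fun δ : ℝ≥0∞ => ENNReal.ofReal c * δ) (𝓝 0) (𝓝 (ENNReal.ofReal c * 0)) :=
        ENNReal.Tendsto.const_mul tendsto_id (Or.inr ENNReal.ofReal_ne_top)
      rw [mul_zero] at this
      have h2 := (this.mono_left (nhdsWithin_le_nhds (s := Ioi 0))).eventually (gt_mem_nhds hε)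
      obtain ⟨δ, h3, h4⟩ := (h2.and (self_mem_nhdsWithin (s := Ioi (0 : ℝ≥0∞)))).exists
      exact ⟨δ, h4, h3⟩
    -- The bound 1 keeps the connecting curves inside the compact set, the bound δ makes them short
    -- in the ambient norm.
    obtain ⟨N', hN'⟩ := hcau (min δ 1) (lt_min hδ one_pos)
    refine ⟨max N N', fun m hm n hn => ?_⟩
    obtain ⟨γ, hγ, hl⟩ := exists_curve_of_riemDist_lt
      (hN' m (le_of_max_le_right hm) n (le_of_max_le_right hn))
    have h1 := hγ.enorm_sub_le hh hC1 (Φ := id) (fun p _ => contDiffAt_id) hc0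
      (s := 1) (by simp) (fun t ht v hv => ?_)
    · simp only [id, hγ.2.2.2] at h1
      rw [edist_comm, edist_eq_enorm_sub]
      refine h1.trans_lt (lt_of_le_of_lt ?_ hδε)
      exact mul_le_mul_right (hl.le.trans (min_le_left _ _)) _
    · rw [fderiv_id]
      refine hc _ (hmem _ (hγ.2.1 t ht) fun i => ?_) v hv
      have h2 := hlog hγ (hl.trans_le (min_le_right _ _)) t ht i
      have h3 := hlogN m (le_of_max_le_left hm) i
      have h4 := abs_sub_abs_le_abs_sub (Real.log (l i (γ t))) (Real.log (l i (u m)))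
      linarith
  obtain ⟨p, hp⟩ := cauchySeq_tendsto_of_complete hcauchy
  have hpK := (hcomp M hM0).isClosed.mem_of_tendsto hp (by
    filter_upwards [eventually_ge_atTop N] with n hn
    exact hmem _ (hu n) fun i => (hlogN n hn i).trans (by linarith [abs_nonneg K]))
  have hpC := hKC hpK
  refine ⟨p, hpC, ?_⟩
  rw [hC] at hpC ⊢
  exact tendsto_riemDist hh hom hUo (fun n => hC1 _ (hu n)) hpC.1 hpC.2 hp

/-! ### Criterion for incompleteness -/

/-- An open part `C` of `{h = 1}` is incomplete if some `C¹` curve leaves it in finite time. -/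
theorem not_riemComplete_of_curve {h : R3 → ℝ} (hh : ContDiff ℝ 2 h) {C U : Set R3}
    (hU : IsOpen U) (hC : C = {p | h p = 1} ∩ U) (hCh : C ⊆ hyperbolicLocus h)
    {σ : ℝ → R3} (hσ : ContDiffOn ℝ 1 σ (Icc 0 1)) (hσC : ∀ t ∈ Ioc (0 : ℝ) 1, σ t ∈ C)
    (hσ0 : σ 0 ∉ C) : ¬ RiemComplete h C := by
  intro hcomplete
  have hC1 : ∀ p ∈ C, h p = 1 := fun p hp => (hCh hp).1
  obtain ⟨B, hB⟩ := isCompact_Icc.exists_bound_of_continuousOn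
    (hσ.continuousOn_derivWithin (uniqueDiffOn_Icc one_pos) le_rfl)
  have hB0 : 0 ≤ B := (norm_nonneg _).trans (hB 0 (by simp))
  obtain ⟨A, hA0, hA⟩ := exists_negHessian_le hh (isCompact_Icc.image_of_continuousOn hσ.continuousOn)
  have hdist : ∀ a ∈ Ioc (0 : ℝ) 1, ∀ b ∈ Ioc (0 : ℝ) 1,
      riemDist h C (σ a) (σ b) ≤ ENNReal.ofReal (A * (B * |b - a|)) := by
    intro a ha b hb
    have hseg : ∀ t ∈ Icc (0 : ℝ) 1, AffineMap.lineMap a b t ∈ Ioc (0 : ℝ) 1 := fun t ht =>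
      (convex_Ioc 0 1).lineMap_mem ha hb ht
    have hcurve : IsCurveFrom C (fun t => σ (AffineMap.lineMap a b t)) (σ a) (σ b) := by
      refine ⟨?_, fun t ht => hσC _ (hseg t ht), by simp, by simp⟩
      exact hσ.comp (ContinuousAffineMap.contDiff (ContinuousAffineMap.lineMap (R := ℝ) a b)).contDiffOn
        fun t ht => Ioc_subset_Icc_self (hseg t ht)
    refine (riemDist_le hcurve).trans (curveLength_le fun t ht => ?_)
    have hm := hseg t (Ioo_subset_Icc_self ht)
    -- σ need not be differentiable at 1. For a ≠ b the parameter stays in the open interval; for a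
    -- = b the curve is constant.
    rcases eq_or_ne a b with rfl | hab
    · simp [negHessian]
    have hm' : AffineMap.lineMap a b t ∈ Ioo (0 : ℝ) 1 := by
      refine ⟨hm.1, ?_⟩
      rw [AffineMap.lineMap_apply, vsub_eq_sub, vadd_eq_add, smul_eq_mul]
      rcases lt_or_gt_of_ne hab with h' | h'
      · nlinarith [ht.1, ht.2, ha.2, hb.2]
      · nlinarith [ht.1, ht.2, ha.2, hb.2]
    have hnhds := Icc_mem_nhds hm'.1 hm'.2
    have h1 : HasDerivAt σ (derivWithin σ (Icc 0 1) (AffineMap.lineMap a b t))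
        (AffineMap.lineMap a b t) :=
      ((hσ.differentiableOn one_ne_zero _ (Ioc_subset_Icc_self hm)).hasDerivWithinAt).hasDerivAt
        hnhds
    have h2 := (h1.scomp t (AffineMap.hasDerivAt_lineMap (a := a) (b := b) (x := t))).deriv
    change deriv (fun t => σ (AffineMap.lineMap a b t)) t = _ at h2
    rw [h2]
    refine Real.sqrt_le_iff.2 ⟨by positivity,
      (hA _ (mem_image_of_mem _ (Ioc_subset_Icc_self hm)) _).trans ?_⟩
    gcongr
    rw [norm_smul, mul_comm, Real.norm_eq_abs]
    gcongr
    exact hB _ (Ioc_subset_Icc_self hm)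
  set s : ℕ → ℝ := fun n => 1 / ((n : ℝ) + 1) with hs
  have hsm : ∀ n, s n ∈ Ioc (0 : ℝ) 1 := fun n => by
    have : (0 : ℝ) < n + 1 := by positivity
    refine ⟨by positivity, ?_⟩
    rw [hs]; simp only; rw [div_le_one this]; simp
  have hs0 : Tendsto s atTop (𝓝 0) := tendsto_one_div_add_atTop_nhds_zero_nat
  obtain ⟨p, hp, hlim⟩ := hcomplete (fun n => σ (s n)) (fun n => hσC _ (hsm n)) (by
    intro ε hε
    have h1 : Tendsto (fun x : ℝ × ℝ => ENNReal.ofReal (A * (B * |x.2 - x.1|))) (𝓝 (0, 0)) (𝓝 0) := by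
      have : Continuous fun x : ℝ × ℝ => ENNReal.ofReal (A * (B * |x.2 - x.1|)) :=
        ENNReal.continuous_ofReal.comp (by fun_prop)
      simpa using this.tendsto (0, 0)
    have h2 := (h1.comp (nhds_prod_eq (x := (0 : ℝ)) (y := (0 : ℝ)) ▸ hs0.prodMap hs0)).eventually (gt_mem_nhds hε)
    rw [prod_atTop_atTop_eq, eventually_atTop_prod_self] at h2
    obtain ⟨N, hN⟩ := h2
    exact ⟨N, fun m hm n hn => (hdist _ (hsm m) _ (hsm n)).trans_lt (hN m n hm hn)⟩)
  have hσlim : Tendsto (fun n => σ (s n)) atTop (𝓝 (σ 0)) := by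
    refine (hσ.continuousOn 0 (by simp)).tendsto.comp (tendsto_nhdsWithin_iff.2 ⟨hs0, ?_⟩)
    exact Eventually.of_forall fun n => Ioc_subset_Icc_self (hsm n)
  have hne : p ≠ σ 0 := fun e => hσ0 (e ▸ hp)
  have hpU : p ∈ U := by rw [hC] at hp; exact hp.2
  -- The bump function equals 1 at p and vanishes at σ 0. It is Lipschitz for the Riemannian
  -- distance because its support meets {h = 1} in a compact part of C.
  obtain ⟨r, hr, hrU⟩ := Metric.isOpen_iff.1 (hU.inter isOpen_compl_singleton) p ⟨hpU, hne⟩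
  let φ : ContDiffBump p := ⟨r / 4, r / 2, by positivity, by linarith⟩
  have hφ : ContDiff ℝ 1 φ := φ.contDiff
  have hKc : IsCompact ({p | h p = 1} ∩ Metric.closedBall p (r / 2)) :=
    (isCompact_closedBall _ _).inter_left (isClosed_eq hh.continuous continuous_const)
  have hsubU : Metric.closedBall p (r / 2) ⊆ U ∩ {σ 0}ᶜ :=
    (Metric.closedBall_subset_ball (by linarith)).trans hrU
  obtain ⟨c, hc0, hc⟩ := exists_norm_le_negHessian hh hKc
    (subset_trans (fun x hx => by rw [hC]; exact ⟨hx.1, (hsubU hx.2).1⟩) hCh)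
  obtain ⟨D, hD⟩ := (isCompact_closedBall p (r / 2)).exists_bound_of_continuousOn
    (hφ.continuous_fderiv one_ne_zero).continuousOn
  have hD0 : 0 ≤ D := (norm_nonneg _).trans (hD p (Metric.mem_closedBall_self (by positivity)))
  have hLip : ∀ q ∈ C, ∀ v, fderiv ℝ h q v = 0 →
      ‖fderiv ℝ φ q v‖ ≤ D * c * Real.sqrt (negHessian h q v v) := by
    intro q hq v hv
    by_cases hqb : q ∈ Metric.closedBall p (r / 2)
    · calc ‖fderiv ℝ φ q v‖ ≤ ‖fderiv ℝ φ q‖ * ‖v‖ := ContinuousLinearMap.le_opNorm _ _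
        _ ≤ D * (c * Real.sqrt (negHessian h q v v)) := by
            gcongr
            · exact hD q hqb
            · exact hc q ⟨hC1 q hq, hqb⟩ v hv
        _ = _ := by ring
    · have : fderiv ℝ φ q = 0 := by
        by_contra h0
        have := support_fderiv_subset ℝ (Function.mem_support.2 h0)
        rw [φ.tsupport_eq] at this
        exact hqb this
      rw [this]; simp; positivity
  -- The added 1 makes the constant positive, so that it can be divided out before passing to the
  -- infimum over curves.
  have hφb : ∀ n, ‖φ p - φ (σ (s n))‖ₑ ≤ riemDist h C (σ (s n)) p * ENNReal.ofReal (D * c + 1) := by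
    intro n
    have hpos : ENNReal.ofReal (D * c + 1) ≠ 0 := (ENNReal.ofReal_pos.2 (by positivity)).ne'
    rw [← ENNReal.div_le_iff_le_mul (Or.inl hpos) (Or.inl ENNReal.ofReal_ne_top), riemDist]
    refine le_iInf₂ fun γ hγ => ?_
    rw [ENNReal.div_le_iff_le_mul (Or.inl hpos) (Or.inl ENNReal.ofReal_ne_top), mul_comm]
    have h1 := IsCurveFrom.enorm_sub_le hh hC1 hγ (fun p _ => hφ.contDiffAt)
      (show 0 ≤ D * c + 1 by positivity) (s := 1) (by simp) (fun t ht v hv =>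
        (hLip _ (hγ.2.1 t ht) v hv).trans (by gcongr; linarith))
    rwa [hγ.2.2.2] at h1
  have hφlim : Tendsto (fun n => ‖φ p - φ (σ (s n))‖ₑ) atTop (𝓝 0) := by
    refine tendsto_of_tendsto_of_tendsto_of_le_of_le tendsto_const_nhds ?_
      (fun _ => zero_le) hφb
    simpa using ENNReal.Tendsto.mul_const hlim (Or.inr (ENNReal.ofReal_ne_top (r := D * c + 1)))
  have hφlim2 : Tendsto (fun n => ‖φ p - φ (σ (s n))‖ₑ) atTop (𝓝 ‖φ p - φ (σ 0)‖ₑ) :=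
    (tendsto_const_nhds.sub ((hφ.continuous.tendsto _).comp hσlim)).enorm
  have h0 := tendsto_nhds_unique hφlim hφlim2
  rw [φ.one_of_mem_closedBall (Metric.mem_closedBall_self (by positivity)),
    φ.zero_of_le_dist (by
      by_contra hlt
      exact (hsubU (Metric.mem_closedBall.2 (not_le.1 hlt).le)).2 rfl)] at h0
  simp at h0

/-! ### Components from a disjoint open cover -/

/-- If `S` is covered by disjoint open sets cutting out connected pieces, these pieces are the
components of `S`. -/
theorem componentsOf_eq_range {ι : Type*} {S : Set R3} {A U : ι → Set R3}
    (hA : ∀ i, IsConnected (A i)) (hU : ∀ i, IsOpen (U i))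
    (hd : ∀ i j, i ≠ j → Disjoint (U i) (U j)) (hAU : ∀ i, A i = S ∩ U i)
    (hcov : ∀ p ∈ S, ∃ i, p ∈ U i) :
    componentsOf S = range A ∧ (componentsOf S).ncard = Nat.card ι := by
  have hcomp : ∀ i, ∀ p ∈ A i, connectedComponentIn S p = A i := by
    intro i p hp
    have hAS : A i ⊆ S := by rw [hAU]; exact inter_subset_left
    have hpS := hAS hp
    refine Subset.antisymm ?_ ((hA i).isPreconnected.subset_connectedComponentIn hp hAS)
    have hsub : connectedComponentIn S p ⊆ U i := by
      -- U i and the union of the other U j are disjoint open sets covering S, and the component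
      -- meets the first.
      refine isPreconnected_connectedComponentIn.subset_left_of_subset_union (hU i)
        (v := ⋃ j ∈ {j | j ≠ i}, U j) (isOpen_biUnion fun j _ => hU j) ?_ ?_ ?_
      · simp only [disjoint_iUnion_right]
        exact fun j hj => hd _ _ (Ne.symm hj)
      · intro q hq
        obtain ⟨j, hj⟩ := hcov q (connectedComponentIn_subset S p hq)
        by_cases hji : j = i
        · exact Or.inl (hji ▸ hj)
        · exact Or.inr (mem_biUnion (show j ∈ {j | j ≠ i} from hji) hj)
      · rw [hAU] at hp
        exact ⟨p, mem_connectedComponentIn hpS, hp.2⟩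
    rw [hAU]
    exact subset_inter (connectedComponentIn_subset S p) hsub
  have hr : componentsOf S = range A := by
    ext C
    constructor
    · rintro ⟨p, hp, rfl⟩
      obtain ⟨i, hi⟩ := hcov p hp
      exact ⟨i, (hcomp i p (by rw [hAU]; exact ⟨hp, hi⟩)).symm⟩
    · rintro ⟨i, rfl⟩
      obtain ⟨p, hp⟩ := (hA i).nonempty
      refine ⟨p, ?_, (hcomp i p hp).symm⟩
      rw [hAU] at hp; exact hp.1
  refine ⟨hr, ?_⟩
  rw [hr, ncard_range_of_injective]
  intro i j hij
  by_contra hne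
  obtain ⟨p, hp⟩ := (hA i).nonempty
  have hp' : p ∈ A j := hij ▸ hp
  rw [hAU] at hp hp'
  exact disjoint_left.1 (hd i j hne) hp.2 hp'.2

/-! ### Differential and Hessian of a ternary cubic -/

/-- `L` and `N` are the differential and the negative Hessian form of the ternary cubic `h`. -/
structure IsCubicWith (h : R3 → ℝ) (L N : R3 → R3 → ℝ) : Prop where
  contDiff : ContDiff ℝ 2 h
  hom : ∀ (t : ℝ) p, h (t • p) = t ^ 3 * h p
  expand : ∀ p v (t : ℝ), h (p + t • v) = h p + L p v * t - N p v / 2 * t ^ 2 + h v * t ^ 3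
  expand_fderiv : ∀ p v (t : ℝ), L (p + t • v) v = L p v - N p v * t + 3 * h v * t ^ 2

namespace IsCubicWith

variable {h : R3 → ℝ} {L N : R3 → R3 → ℝ}

theorem fderiv_eq (H : IsCubicWith h L N) (p v : R3) : fderiv ℝ h p v = L p v := by
  -- The derivative in direction v is the coefficient of t in the expansion along the line p + t v.
  rw [← (H.contDiff.differentiable (by norm_num) p).lineDeriv_eq_fderiv, lineDeriv]
  simp only [H.expand]
  have h1 : HasDerivAt (fun t : ℝ => h p + L p v * t - N p v / 2 * t ^ 2 + h v * t ^ 3)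
      (0 + L p v * 1 - N p v / 2 * ((2 : ℕ) * 0 ^ 1 * 1) + h v * ((3 : ℕ) * 0 ^ 2 * 1)) 0 :=
    (((hasDerivAt_const _ _).add ((hasDerivAt_id _).const_mul _)).sub
      (((hasDerivAt_id _).pow 2).const_mul _)).add (((hasDerivAt_id _).pow 3).const_mul _)
  rw [h1.deriv]; simp

theorem negHessian_eq (H : IsCubicWith h L N) (p v : R3) : negHessian h p v v = N p v := by
  have hd : DifferentiableAt ℝ (fderiv ℝ h) p :=
    (H.contDiff.fderiv_right (m := 1) (by norm_num)).differentiable (by norm_num) p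
  have h0 : fderiv ℝ (fderiv ℝ h) p v v = fderiv ℝ (fun q => L q v) p v := by
    have : (fun q => L q v) = fun q => fderiv ℝ h q v := funext fun q => (H.fderiv_eq q v).symm
    rw [this, fderiv_clm_apply hd (differentiableAt_const v)]
    simp
  have hd' : DifferentiableAt ℝ (fun q => L q v) p := by
    have : (fun q => L q v) = fun q => fderiv ℝ h q v := funext fun q => (H.fderiv_eq q v).symm
    rw [this]
    exact hd.clm_apply (differentiableAt_const v)
  -- Likewise the Hessian at (v, v) is the coefficient of t in L (p + t v) v.
  rw [negHessian, h0, ← hd'.lineDeriv_eq_fderiv, lineDeriv]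
  simp only [H.expand_fderiv]
  have h1 : HasDerivAt (fun t : ℝ => L p v - N p v * t + 3 * h v * t ^ 2)
      (0 - N p v * 1 + 3 * h v * ((2 : ℕ) * 0 ^ 1 * 1)) 0 :=
    ((hasDerivAt_const _ _).sub ((hasDerivAt_id _).const_mul _)).add
      (((hasDerivAt_id _).pow 2).const_mul _)
  rw [h1.deriv]; simp

theorem mem_hyperbolicLocus (H : IsCubicWith h L N) {p : R3} : p ∈ hyperbolicLocus h ↔
    h p = 1 ∧ ∀ v, L p v = 0 → v ≠ 0 → 0 < N p v := by
  simp only [hyperbolicLocus, H.fderiv_eq, H.negHessian_eq]; rfl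

end IsCubicWith

theorem isCubicWith_cubic1 : IsCubicWith cubic1
    (fun p v => p 1 * p 2 * v 0 + p 0 * p 2 * v 1 + p 0 * p 1 * v 2)
    (fun p v => -2 * (p 2 * v 0 * v 1 + p 1 * v 0 * v 2 + p 0 * v 1 * v 2)) where
  contDiff := by unfold cubic1; fun_prop
  hom t p := by simp [cubic1]; ring
  expand p v t := by simp [cubic1]; ring
  expand_fderiv p v t := by simp [cubic1]; ring

theorem isCubicWith_cubic2 : IsCubicWith cubic2
    (fun p v => (2 * p 0 * p 1 - p 2 ^ 2) * v 0 + p 0 ^ 2 * v 1 - 2 * p 0 * p 2 * v 2)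
    (fun p v => -2 * p 1 * v 0 ^ 2 - 4 * p 0 * v 0 * v 1 + 2 * p 0 * v 2 ^ 2
      + 4 * p 2 * v 0 * v 2) where
  contDiff := by unfold cubic2; fun_prop
  hom t p := by simp [cubic2]; ring
  expand p v t := by simp [cubic2]; ring
  expand_fderiv p v t := by simp [cubic2]; ring

theorem isCubicWith_cubic3 : IsCubicWith cubic3
    (fun p v => (p 1 * p 2 + 3 * p 0 ^ 2) * v 0 + p 0 * p 2 * v 1 + p 0 * p 1 * v 2)
    (fun p v => -(6 * p 0 * v 0 ^ 2 + 2 * p 2 * v 0 * v 1 + 2 * p 1 * v 0 * v 2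
      + 2 * p 0 * v 1 * v 2)) where
  contDiff := by unfold cubic3; fun_prop
  hom t p := by simp [cubic3]; ring
  expand p v t := by simp [cubic3]; ring
  expand_fderiv p v t := by simp [cubic3]; ring

theorem isCubicWith_cubic4 : IsCubicWith cubic4
    (fun p v => 2 * p 0 * p 2 * v 0 + 2 * p 1 * p 2 * v 1
      + (p 0 ^ 2 + p 1 ^ 2 - 3 * p 2 ^ 2) * v 2)
    (fun p v => -(2 * p 2 * (v 0 ^ 2 + v 1 ^ 2) + 4 * v 2 * (p 0 * v 0 + p 1 * v 1)
      - 6 * p 2 * v 2 ^ 2)) where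
  contDiff := by unfold cubic4; fun_prop
  hom t p := by simp [cubic4]; ring
  expand p v t := by simp [cubic4]; ring
  expand_fderiv p v t := by simp [cubic4]; ring

theorem isCubicWith_cubic5 : IsCubicWith cubic5
    (fun p v => (p 1 ^ 2 - p 2 ^ 2) * v 0 + (2 * p 0 * p 1 + 3 * p 1 ^ 2) * v 1
      - 2 * p 0 * p 2 * v 2)
    (fun p v => -(2 * p 0 * (v 1 ^ 2 - v 2 ^ 2) + 4 * v 0 * (p 1 * v 1 - p 2 * v 2)
      + 6 * p 1 * v 1 ^ 2)) where
  contDiff := by unfold cubic5; fun_prop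
  hom t p := by simp [cubic5]; ring
  expand p v t := by simp [cubic5]; ring
  expand_fderiv p v t := by simp [cubic5]; ring

theorem isCubicWith_cubic6 : IsCubicWith cubic6
    (fun p v => (p 1 ^ 2 + p 2 ^ 2) * v 0 + (2 * p 0 * p 1 + 3 * p 1 ^ 2) * v 1
      + 2 * p 0 * p 2 * v 2)
    (fun p v => -(2 * p 0 * (v 1 ^ 2 + v 2 ^ 2) + 4 * v 0 * (p 1 * v 1 + p 2 * v 2)
      + 6 * p 1 * v 1 ^ 2)) where
  contDiff := by unfold cubic6; fun_prop
  hom t p := by simp [cubic6]; ring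
  expand p v t := by simp [cubic6]; ring
  expand_fderiv p v t := by simp [cubic6]; ring

theorem isCubicWith_cubic7 : IsCubicWith cubic7
    (fun p v => p 2 ^ 2 * v 0 + 3 * p 1 ^ 2 * v 1 + 2 * p 0 * p 2 * v 2)
    (fun p v => -(4 * p 2 * v 0 * v 2 + 2 * p 0 * v 2 ^ 2 + 6 * p 1 * v 1 ^ 2)) where
  contDiff := by unfold cubic7; fun_prop
  hom t p := by simp [cubic7]; ring
  expand p v t := by simp [cubic7]; ring
  expand_fderiv p v t := by simp [cubic7]; ring

/-! ### The metric on tangent planes and the hyperbolic loci -/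

theorem R3_ext {v : R3} (h0 : v 0 = 0) (h1 : v 1 = 0) (h2 : v 2 = 0) : v = 0 := by
  ext i; fin_cases i <;> assumption

/-- With A = a/x, B = b/y, C = c/z and xyz = 1 the left side is -2(AB + BC + CA), which is A² + B² +
C² because tangency says A + B + C = 0. -/
theorem metric_cubic1 {x y z a b c : ℝ} (h : x * y * z = 1)
    (hL : y * z * a + x * z * b + x * y * c = 0) :
    -2 * (z * a * b + y * a * c + x * b * c) =
      (y * z * a) ^ 2 + (x * z * b) ^ 2 + (x * y * c) ^ 2 := by
  linear_combination 2 * (z * a * b + y * a * c + x * b * c) * h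
    - (y * z * a + x * z * b + x * y * c) * hL

theorem hyperbolicLocus_cubic1 : hyperbolicLocus cubic1 = {p | cubic1 p = 1} := by
  ext p
  rw [isCubicWith_cubic1.mem_hyperbolicLocus]
  refine ⟨fun h => h.1, fun h => ⟨h, fun v hL hv => ?_⟩⟩
  simp only [cubic1, mem_ofPred_eq] at h
  rw [metric_cubic1 h hL]
  by_contra hn
  have h0 : p 0 ≠ 0 := by rintro e; simp [e] at h
  have h1 : p 1 ≠ 0 := by rintro e; simp [e] at h
  have h2 : p 2 ≠ 0 := by rintro e; simp [e] at h
  refine hv (R3_ext ?_ ?_ ?_)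
  · have : p 1 * p 2 * v 0 = 0 := by
      nlinarith [sq_nonneg (p 1 * p 2 * v 0), sq_nonneg (p 0 * p 2 * v 1),
        sq_nonneg (p 0 * p 1 * v 2)]
    simpa [h1, h2] using this
  · have : p 0 * p 2 * v 1 = 0 := by
      nlinarith [sq_nonneg (p 1 * p 2 * v 0), sq_nonneg (p 0 * p 2 * v 1),
        sq_nonneg (p 0 * p 1 * v 2)]
    simpa [h0, h2] using this
  · have : p 0 * p 1 * v 2 = 0 := by
      nlinarith [sq_nonneg (p 1 * p 2 * v 0), sq_nonneg (p 0 * p 2 * v 1),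
        sq_nonneg (p 0 * p 1 * v 2)]
    simpa [h0, h1] using this

theorem metric_cubic2 {x y z a b c : ℝ} (h : x * (x * y - z ^ 2) = 1)
    (hL : (2 * x * y - z ^ 2) * a + x ^ 2 * b - 2 * x * z * c = 0) :
    -2 * y * a ^ 2 - 4 * x * a * b + 2 * x * c ^ 2 + 4 * z * a * c =
      6 * a ^ 2 / x ^ 2 + 2 * (x * c - z * a) ^ 2 / x := by
  have hx : x ≠ 0 := by rintro rfl; simp at h
  obtain rfl : y = (1 / x + z ^ 2) / x := by field_simp; linarith
  obtain rfl : b = -((2 * x * ((1 / x + z ^ 2) / x) - z ^ 2) * a - 2 * x * z * c) / x ^ 2 := by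
    rw [eq_div_iff (by positivity)]; linarith
  field_simp
  ring

theorem hyperbolicLocus_cubic2 : hyperbolicLocus cubic2 = {p | cubic2 p = 1 ∧ 0 < p 0} := by
  ext p
  rw [isCubicWith_cubic2.mem_hyperbolicLocus, mem_ofPred_eq]
  refine and_congr_right fun h => ?_
  simp only [cubic2] at h
  have hx : p 0 ≠ 0 := by rintro e; simp [e] at h
  constructor
  · intro H
    -- A tangent vector with vanishing first coordinate; the metric takes the value 2x on it.
    have := H ![0, 2 * p 2 / p 0, 1] (by simp; field_simp; ring) (fun e => by
      have := congrFun e 2; simp at this)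
    simpa using this
  · intro hpos v hL hv
    rw [metric_cubic2 h hL]
    by_contra hn
    have h1 : 0 ≤ 6 * v 0 ^ 2 / p 0 ^ 2 := by positivity
    have h2 : 0 ≤ 2 * (p 0 * v 2 - p 2 * v 0) ^ 2 / p 0 := by positivity
    have h3 : 6 * v 0 ^ 2 / p 0 ^ 2 = 0 := by linarith
    have h4 : 2 * (p 0 * v 2 - p 2 * v 0) ^ 2 / p 0 = 0 := by linarith
    have h5 : v 0 = 0 := by simpa [hx] using h3
    have h6 : v 2 = 0 := by simpa [hx, h5] using h4
    refine hv (R3_ext h5 ?_ h6)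
    simpa [h5, h6, hx] using hL

/-- Since xyz = 1 - x³, the logarithmic differentials a/x, b/y, c/z are natural coordinates, and the
form is diagonal in a/x and b/y - c/z. For 1 - x³ > 0 positivity depends only on the sign of 1 -
4x³. -/
theorem metric_cubic3 {x y z a b c : ℝ} (h : x * (y * z + x ^ 2) = 1) (hx3 : 1 - x ^ 3 ≠ 0)
    (hL : (y * z + 3 * x ^ 2) * a + x * z * b + x * y * c = 0) :
    -(6 * x * a ^ 2 + 2 * z * a * b + 2 * y * a * c + 2 * x * b * c) =
      (1 - x ^ 3) * (b / y - c / z) ^ 2 / 2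
        + 3 / 2 * (a / x) ^ 2 * (1 - 4 * x ^ 3) / (1 - x ^ 3) := by
  have hx : x ≠ 0 := by rintro rfl; simp at h
  have hyz : x * y * z = 1 - x ^ 3 := by linarith
  have hy : y ≠ 0 := by rintro rfl; simp at hyz; exact hx3 hyz.symm
  obtain rfl : z = (1 - x ^ 3) / (x * y) := by field_simp; linarith
  obtain rfl : c = -((y * ((1 - x ^ 3) / (x * y)) + 3 * x ^ 2) * a
      + x * ((1 - x ^ 3) / (x * y)) * b) / (x * y) := by
    rw [eq_div_iff (by positivity)]; linarith
  field_simp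
  ring

theorem lt_inv_cbrt_four_iff {x : ℝ} : x < 1 / (4 : ℝ) ^ ((1 : ℝ) / 3) ↔ 4 * x ^ 3 < 1 := by
  have h4 : (((4 : ℝ) ^ ((1 : ℝ) / 3)) ^ 3) = 4 := by
    rw [← Real.rpow_natCast, ← Real.rpow_mul (by norm_num)]; norm_num
  have hpos : (0 : ℝ) < (4 : ℝ) ^ ((1 : ℝ) / 3) := by positivity
  rw [← (Odd.strictMono_pow (n := 3) (by decide)).lt_iff_lt (a := x), div_pow, h4, one_pow,
    lt_div_iff₀ (by norm_num), mul_comm]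

theorem hyperbolicLocus_cubic3_eq : hyperbolicLocus cubic3 =
    {p | cubic3 p = 1 ∧ 4 * p 0 ^ 3 < 1} := by
  ext p
  rw [isCubicWith_cubic3.mem_hyperbolicLocus, mem_ofPred_eq]
  refine and_congr_right fun h => ?_
  simp only [cubic3] at h
  have hx : p 0 ≠ 0 := by rintro e; simp [e] at h
  have hxyz : p 0 * p 1 * p 2 = 1 - p 0 ^ 3 := by linarith
  constructor
  · intro H
    by_contra! hlt
    -- For x = 1 one has yz = 0 and the diagonal form is not available; the explicit tangent vector
    -- chosen here has metric value -2.
    by_cases h1 : 1 - p 0 ^ 3 = 0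
    · have hx1 : p 0 = 1 := by
        have : (p 0 - 1) * (p 0 ^ 2 + p 0 + 1) = 0 := by linear_combination -h1
        rcases mul_eq_zero.1 this with h' | h'
        · linarith
        · nlinarith [sq_nonneg (p 0 + 1)]
      have hyz : p 1 * p 2 = 0 := by rw [hx1] at hxyz; linarith
      have := H ![-(p 1 + p 2) / 3, 1, 1]
        (by simp [hx1, hyz]; ring) (fun e => by have := congrFun e 1; simp at this)
      simp [hx1] at this
      nlinarith [sq_nonneg (p 1 + p 2)]
    · have hy : p 1 ≠ 0 := by rintro e; simp [e] at hxyz; exact h1 hxyz.symm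
      have hz : p 2 ≠ 0 := by rintro e; simp [e] at hxyz; exact h1 hxyz.symm
      rcases lt_or_gt_of_ne h1 with h2 | h2
      -- Here a = 0, so only the square with coefficient 1 - x³ < 0 remains.
      · have hL : (p 1 * p 2 + 3 * p 0 ^ 2) * (![0, p 1, - p 2] : R3) 0
          + p 0 * p 2 * (![0, p 1, - p 2] : R3) 1 + p 0 * p 1 * (![0, p 1, - p 2] : R3) 2 = 0 := by
          simp; ring
        have := H _ hL (fun e => by have := congrFun e 1; simp [hy] at this)
        rw [metric_cubic3 h h1 hL] at this
        simp [hy, hz] at this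
        linarith
      -- The choice b/y = c/z kills the first square and leaves the one whose sign is that of 1 -
      -- 4x³.
      · have hL : (p 1 * p 2 + 3 * p 0 ^ 2) * (![-2 * p 0 * (1 - p 0 ^ 3), p 1 * (1 + 2 * p 0 ^ 3), p 2 * (1 + 2 * p 0 ^ 3)] : R3) 0
          + p 0 * p 2 * (![-2 * p 0 * (1 - p 0 ^ 3), p 1 * (1 + 2 * p 0 ^ 3), p 2 * (1 + 2 * p 0 ^ 3)] : R3) 1 + p 0 * p 1 * (![-2 * p 0 * (1 - p 0 ^ 3), p 1 * (1 + 2 * p 0 ^ 3), p 2 * (1 + 2 * p 0 ^ 3)] : R3) 2 = 0 := by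
          simp
          linear_combination (6 * p 0 ^ 3) * hxyz
        have := H _ hL (fun e => by have := congrFun e 0; simp [hx, h1] at this)
        rw [metric_cubic3 h h1 hL] at this
        simp [hy, hz, mul_div_cancel_left₀] at this
        rw [lt_div_iff₀ h2] at this
        nlinarith [sq_nonneg (-(2 * p 0 * (1 - p 0 ^ 3)) / p 0)]
  · intro hpos v hL hv
    have hP : 0 < 1 - p 0 ^ 3 := by linarith
    have hy : p 1 ≠ 0 := by rintro e; simp [e] at hxyz; exact hP.ne' hxyz.symm
    have hz : p 2 ≠ 0 := by rintro e; simp [e] at hxyz; exact hP.ne' hxyz.symm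
    have hQ : 0 < 1 - 4 * p 0 ^ 3 := by linarith
    rw [metric_cubic3 h hP.ne' hL]
    by_contra hn
    have h1 : 0 ≤ (1 - p 0 ^ 3) * (v 1 / p 1 - v 2 / p 2) ^ 2 / 2 := by positivity
    have h2 : 0 ≤ 3 / 2 * (v 0 / p 0) ^ 2 * (1 - 4 * p 0 ^ 3) / (1 - p 0 ^ 3) := by positivity
    have h3 : (1 - p 0 ^ 3) * (v 1 / p 1 - v 2 / p 2) ^ 2 / 2 = 0 := by linarith
    have h4 : 3 / 2 * (v 0 / p 0) ^ 2 * (1 - 4 * p 0 ^ 3) / (1 - p 0 ^ 3) = 0 := by linarith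
    have h5 : v 0 = 0 := by simpa [hx, hP.ne', hQ.ne'] using h4
    have h6 : v 1 / p 1 = v 2 / p 2 := by
      have : v 1 / p 1 - v 2 / p 2 = 0 := by simpa [hP.ne'] using h3
      linarith
    rw [div_eq_div_iff hy hz] at h6
    have h7 : p 0 * p 1 * v 2 = 0 := by
      rw [h5] at hL; linear_combination hL / 2 - p 0 * h6 / 2
    have h8 : v 2 = 0 := by simpa [hx, hy] using h7
    rw [h8] at h6
    exact hv (R3_ext h5 (by simpa [hz] using h6) h8)

theorem hyperbolicLocus_cubic3 : hyperbolicLocus cubic3 =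
    {p | cubic3 p = 1 ∧ p 0 < 1 / (4 : ℝ) ^ ((1 : ℝ) / 3)} := by
  simp only [hyperbolicLocus_cubic3_eq, lt_inv_cbrt_four_iff]

/-- On `{z(x² + y² - z²) = 1, z < 0}` the metric dominates `dz² / z²`. -/
theorem metric_cubic4 {x y z a b c : ℝ} (h : z * (x ^ 2 + y ^ 2 - z ^ 2) = 1) (hz : z < 0)
    (hL : 2 * x * z * a + 2 * y * z * b + (x ^ 2 + y ^ 2 - 3 * z ^ 2) * c = 0) :
    c ^ 2 ≤ z ^ 2 * -(2 * z * (a ^ 2 + b ^ 2) + 4 * c * (x * a + y * b) - 6 * z * c ^ 2) := by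
  set N := -(2 * z * (a ^ 2 + b ^ 2) + 4 * c * (x * a + y * b) - 6 * z * c ^ 2) with hN
  have hlt : x ^ 2 + y ^ 2 < z ^ 2 := by
    by_contra! hle
    nlinarith [mul_nonneg (neg_nonneg.2 hz.le) (sub_nonneg.2 hle)]
  have hr : 0 ≤ x ^ 2 + y ^ 2 := by positivity
  -- On the axis x = y = 0 the tangent plane is horizontal and c = 0. Off the axis, tangency
  -- expresses the radial part xa + yb through c, and N splits into c² and the square of the angular
  -- part xb - ya.
  rcases hr.eq_or_lt with h0 | hr
  · have hx : x = 0 := by nlinarith [sq_nonneg x, sq_nonneg y]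
    have hy : y = 0 := by nlinarith [sq_nonneg x, sq_nonneg y]
    subst hx hy
    have hc : c = 0 := by simpa [hz.ne] using hL
    subst hc
    have : 0 ≤ -z * (2 * (a ^ 2 + b ^ 2)) := mul_nonneg (by linarith) (by positivity)
    have hN0 : 0 ≤ N := by rw [hN]; linarith
    have := mul_nonneg (sq_nonneg z) hN0
    linarith
  · have hid : 2 * z ^ 2 * (x ^ 2 + y ^ 2) * N = 3 * (3 * z ^ 2 + x ^ 2 + y ^ 2) * c ^ 2
        + 4 * -z * z ^ 2 * (x * b - y * a) ^ 2 := by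
      rw [hN]
      linear_combination 3 * (3 * z ^ 2 + x ^ 2 + y ^ 2) * c ^ 2 * h
        + (- z * (2 * z * (x * a + y * b) - (x ^ 2 + y ^ 2 - 3 * z ^ 2) * c)
          - 4 * z * (x ^ 2 + y ^ 2) * c) * hL
    have h1 : 0 ≤ 4 * -z * z ^ 2 * (x * b - y * a) ^ 2 :=
      mul_nonneg (mul_nonneg (by linarith) (sq_nonneg _)) (sq_nonneg _)
    have h2 : (x ^ 2 + y ^ 2) * c ^ 2 ≤ (x ^ 2 + y ^ 2) * (z ^ 2 * N) := by
      nlinarith [mul_nonneg (sub_nonneg.2 hlt.le) (sq_nonneg c), mul_nonneg hr.le (sq_nonneg c)]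
    exact le_of_mul_le_mul_left h2 hr

theorem hyperbolicLocus_cubic4 : hyperbolicLocus cubic4 = {p | cubic4 p = 1 ∧ p 2 < 0} := by
  ext p
  rw [isCubicWith_cubic4.mem_hyperbolicLocus, mem_ofPred_eq]
  refine and_congr_right fun h => ?_
  simp only [cubic4] at h
  constructor
  · intro H
    by_contra! hz
    have h0 : p 0 ^ 2 + p 1 ^ 2 ≠ 0 := fun h0 => by
      rw [h0] at h; nlinarith [pow_nonneg hz 3]
    -- The rotation field around the z-axis is tangent, with metric value -2z(x² + y²).
    have := H ![-p 1, p 0, 0] (by simp; ring) (fun e => h0 (by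
      have h1 := congrFun e 0; have h2 := congrFun e 1
      simp at h1 h2; simp [h1, h2]))
    simp at this
    nlinarith [mul_nonneg hz (add_nonneg (sq_nonneg (p 1)) (sq_nonneg (p 0)))]
  · intro hz v hL hv
    have hm := metric_cubic4 h hz hL
    by_contra hn
    have h2 : v 2 = 0 := by
      nlinarith [mul_nonneg (sq_nonneg (p 2)) (neg_nonneg.2 (not_lt.1 hn)), sq_nonneg (v 2)]
    simp [h2] at hn
    have h3 : v 0 ^ 2 + v 1 ^ 2 ≤ 0 := by
      by_contra! hlt
      nlinarith [mul_pos (neg_pos.2 hz) hlt]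
    refine hv (R3_ext ?_ ?_ h2) <;> nlinarith [sq_nonneg (v 0), sq_nonneg (v 1)]

/-- Solving h = 1 for x and the tangent equation for a leaves a form in b, c. It is diagonal in yb -
zc, half the differential of y² - z², and zb - yc. -/
theorem metric_cubic5 {x y z a b c : ℝ} (h : x * (y ^ 2 - z ^ 2) + y ^ 3 = 1)
    (hq : y ^ 2 - z ^ 2 ≠ 0)
    (hL : (y ^ 2 - z ^ 2) * a + (2 * x * y + 3 * y ^ 2) * b - 2 * x * z * c = 0) :
    (y ^ 2 - z ^ 2) ^ 2 * -(2 * x * (b ^ 2 - c ^ 2) + 4 * a * (y * b - z * c) + 6 * y * b ^ 2) =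
      6 * (y * b - z * c) ^ 2 + 2 * (1 - y * (y ^ 2 + 3 * z ^ 2)) * (z * b - y * c) ^ 2 := by
  obtain rfl : x = (1 - y ^ 3) / (y ^ 2 - z ^ 2) := by rw [eq_div_iff hq]; linarith
  obtain rfl : a = -((2 * ((1 - y ^ 3) / (y ^ 2 - z ^ 2)) * y + 3 * y ^ 2) * b
      - 2 * ((1 - y ^ 3) / (y ^ 2 - z ^ 2)) * z * c) / (y ^ 2 - z ^ 2) := by
    rw [eq_div_iff hq]; linarith
  field_simp
  ring

theorem hyperbolicLocus_cubic5 : hyperbolicLocus cubic5 =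
    {p | cubic5 p = 1 ∧ p 1 ^ 2 - p 2 ^ 2 ≠ 0 ∧ p 1 * (p 1 ^ 2 + 3 * p 2 ^ 2) < 1} := by
  ext p
  rw [isCubicWith_cubic5.mem_hyperbolicLocus, mem_ofPred_eq]
  refine and_congr_right fun h => ?_
  simp only [cubic5] at h
  constructor
  · intro H
    have hq : p 1 ^ 2 - p 2 ^ 2 ≠ 0 := fun hq => by
      -- Where y² = z², the x-direction is tangent and null for the metric.
      have := H ![1, 0, 0] (by simp [hq]) (fun e => by have := congrFun e 0; simp at this)
      simp at this
    refine ⟨hq, ?_⟩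
    -- (b, c) = (z, y) makes yb - zc vanish; the first coordinate then solves the tangent equation.
    have hL : (p 1 ^ 2 - p 2 ^ 2) * (![-3 * p 1 ^ 2 * p 2 / (p 1 ^ 2 - p 2 ^ 2), p 2, p 1] : R3) 0
        + (2 * p 0 * p 1 + 3 * p 1 ^ 2) *
          (![-3 * p 1 ^ 2 * p 2 / (p 1 ^ 2 - p 2 ^ 2), p 2, p 1] : R3) 1
        - 2 * p 0 * p 2 * (![-3 * p 1 ^ 2 * p 2 / (p 1 ^ 2 - p 2 ^ 2), p 2, p 1] : R3) 2 = 0 := by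
      simp [mul_div_cancel₀, hq]; ring
    have h1 := H _ hL (fun e => hq (by
      have h1 := congrFun e 1; have h2 := congrFun e 2
      simp at h1 h2; simp [h1, h2]))
    have h2 := metric_cubic5 h hq hL
    have h3 := mul_pos (pow_pos (abs_pos.2 hq) 2) h1
    rw [sq_abs, h2] at h3
    simp at h3
    nlinarith [sq_nonneg (p 2 * p 2 - p 1 * p 1)]
  · rintro ⟨hq, hpos⟩ v hL hv
    have h2 := metric_cubic5 h hq hL
    by_contra hn
    have h3 := mul_nonneg (sq_nonneg (p 1 ^ 2 - p 2 ^ 2)) (neg_nonneg.2 (not_lt.1 hn))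
    rw [mul_neg, h2] at h3
    have hN : 0 < 1 - p 1 * (p 1 ^ 2 + 3 * p 2 ^ 2) := by linarith
    have h4 : 0 ≤ 2 * (1 - p 1 * (p 1 ^ 2 + 3 * p 2 ^ 2)) * (p 2 * v 1 - p 1 * v 2) ^ 2 := by
      positivity
    have hm : p 1 * v 1 - p 2 * v 2 = 0 := by
      nlinarith [sq_nonneg (p 1 * v 1 - p 2 * v 2)]
    have h5 : 2 * (1 - p 1 * (p 1 ^ 2 + 3 * p 2 ^ 2)) * (p 2 * v 1 - p 1 * v 2) ^ 2 = 0 := by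
      nlinarith [sq_nonneg (p 1 * v 1 - p 2 * v 2)]
    have hk : p 2 * v 1 - p 1 * v 2 = 0 := by simpa [hN.ne'] using h5
    have h6 : (p 1 ^ 2 - p 2 ^ 2) * v 1 = 0 := by linear_combination p 1 * hm - p 2 * hk
    have h7 : (p 1 ^ 2 - p 2 ^ 2) * v 2 = 0 := by linear_combination p 2 * hm - p 1 * hk
    have h8 : v 1 = 0 := by simpa [hq] using h6
    have h9 : v 2 = 0 := by simpa [hq] using h7
    refine hv (R3_ext ?_ h8 h9)
    simpa [h8, h9, hq] using hL

/-- This is `metric_cubic5` with z and c replaced by iz and ic. The coefficient y(y² - 3z²) is the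
real part of (y + iz)³, whence three regions. -/
theorem metric_cubic6 {x y z a b c : ℝ} (h : x * (y ^ 2 + z ^ 2) + y ^ 3 = 1)
    (hq : y ^ 2 + z ^ 2 ≠ 0)
    (hL : (y ^ 2 + z ^ 2) * a + (2 * x * y + 3 * y ^ 2) * b + 2 * x * z * c = 0) :
    (y ^ 2 + z ^ 2) ^ 2 * -(2 * x * (b ^ 2 + c ^ 2) + 4 * a * (y * b + z * c) + 6 * y * b ^ 2) =
      6 * (y * b + z * c) ^ 2 + 2 * (y * (y ^ 2 - 3 * z ^ 2) - 1) * (z * b - y * c) ^ 2 := by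
  obtain rfl : x = (1 - y ^ 3) / (y ^ 2 + z ^ 2) := by rw [eq_div_iff hq]; linarith
  obtain rfl : a = -((2 * ((1 - y ^ 3) / (y ^ 2 + z ^ 2)) * y + 3 * y ^ 2) * b
      + 2 * ((1 - y ^ 3) / (y ^ 2 + z ^ 2)) * z * c) / (y ^ 2 + z ^ 2) := by
    rw [eq_div_iff hq]; linarith
  field_simp
  ring

theorem hyperbolicLocus_cubic6 : hyperbolicLocus cubic6 =
    {p | cubic6 p = 1 ∧ 1 < p 1 * (p 1 ^ 2 - 3 * p 2 ^ 2)} := by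
  ext p
  rw [isCubicWith_cubic6.mem_hyperbolicLocus, mem_ofPred_eq]
  refine and_congr_right fun h => ?_
  simp only [cubic6] at h
  have hq : p 1 ^ 2 + p 2 ^ 2 ≠ 0 := fun hq => by
    have h1 : p 1 = 0 := by nlinarith [sq_nonneg (p 1), sq_nonneg (p 2)]
    have h2 : p 2 = 0 := by nlinarith [sq_nonneg (p 1), sq_nonneg (p 2)]
    simp [h1, h2] at h
  constructor
  · intro H
    have hL : (p 1 ^ 2 + p 2 ^ 2) * (![-3 * p 1 ^ 2 * p 2 / (p 1 ^ 2 + p 2 ^ 2), p 2, -p 1] : R3) 0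
        + (2 * p 0 * p 1 + 3 * p 1 ^ 2) *
          (![-3 * p 1 ^ 2 * p 2 / (p 1 ^ 2 + p 2 ^ 2), p 2, -p 1] : R3) 1
        + 2 * p 0 * p 2 * (![-3 * p 1 ^ 2 * p 2 / (p 1 ^ 2 + p 2 ^ 2), p 2, -p 1] : R3) 2 = 0 := by
      simp [mul_div_cancel₀, hq]; ring
    have h1 := H _ hL (fun e => hq (by
      have h1 := congrFun e 1; have h2 := congrFun e 2
      simp at h1 h2; simp [h1, h2]))
    have h2 := metric_cubic6 h hq hL
    have h3 := mul_pos (pow_pos (abs_pos.2 hq) 2) h1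
    rw [sq_abs, h2] at h3
    simp at h3
    nlinarith [sq_nonneg (p 2 * p 2 + p 1 * p 1)]
  · rintro hpos v hL hv
    have h2 := metric_cubic6 h hq hL
    by_contra hn
    have h3 := mul_nonneg (sq_nonneg (p 1 ^ 2 + p 2 ^ 2)) (neg_nonneg.2 (not_lt.1 hn))
    rw [mul_neg, h2] at h3
    have hN : 0 < p 1 * (p 1 ^ 2 - 3 * p 2 ^ 2) - 1 := by linarith
    have h4 : 0 ≤ 2 * (p 1 * (p 1 ^ 2 - 3 * p 2 ^ 2) - 1) * (p 2 * v 1 - p 1 * v 2) ^ 2 := by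
      positivity
    have hm : p 1 * v 1 + p 2 * v 2 = 0 := by
      nlinarith [sq_nonneg (p 1 * v 1 + p 2 * v 2)]
    have h5 : 2 * (p 1 * (p 1 ^ 2 - 3 * p 2 ^ 2) - 1) * (p 2 * v 1 - p 1 * v 2) ^ 2 = 0 := by
      nlinarith [sq_nonneg (p 1 * v 1 + p 2 * v 2)]
    have hk : p 2 * v 1 - p 1 * v 2 = 0 := by simpa [hN.ne'] using h5
    have h6 : (p 1 ^ 2 + p 2 ^ 2) * v 1 = 0 := by linear_combination p 1 * hm + p 2 * hk
    have h7 : (p 1 ^ 2 + p 2 ^ 2) * v 2 = 0 := by linear_combination p 2 * hm - p 1 * hk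
    have h8 : v 1 = 0 := by simpa [hq] using h6
    have h9 : v 2 = 0 := by simpa [hq] using h7
    refine hv (R3_ext ?_ h8 h9)
    simpa [h8, h9, hq] using hL

theorem metric_cubic7 {x y z a b c : ℝ} (h : x * z ^ 2 + y ^ 3 = 1) (hz : z ≠ 0)
    (hL : z ^ 2 * a + 3 * y ^ 2 * b + 2 * x * z * c = 0) :
    -(4 * z * a * c + 2 * x * c ^ 2 + 6 * y * b ^ 2) =
      6 * ((c / z) ^ 2 - y * (b - y * (c / z)) ^ 2) := by
  obtain rfl : x = (1 - y ^ 3) / z ^ 2 := by rw [eq_div_iff (by positivity)]; linarith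
  obtain rfl : a = -(3 * y ^ 2 * b + 2 * ((1 - y ^ 3) / z ^ 2) * z * c) / z ^ 2 := by
    rw [eq_div_iff (by positivity)]; linarith
  field_simp
  ring

theorem hyperbolicLocus_cubic7 : hyperbolicLocus cubic7 = {p | cubic7 p = 1 ∧ p 1 < 0} := by
  ext p
  rw [isCubicWith_cubic7.mem_hyperbolicLocus, mem_ofPred_eq]
  refine and_congr_right fun h => ?_
  simp only [cubic7] at h
  constructor
  · intro H
    have hz : p 2 ≠ 0 := fun hz => by
      have := H ![1, 0, 0] (by simp [hz]) (fun e => by have := congrFun e 0; simp at this)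
      simp at this
    -- The tangent vector with b = 1, c = 0, of metric value -6y.
    have := H ![-3 * p 1 ^ 2 / p 2 ^ 2, 1, 0] (by simp; field_simp; simp)
      (fun e => by have := congrFun e 1; simp at this)
    simp at this
    linarith
  · intro hy v hL hv
    have hz : p 2 ≠ 0 := fun hz => by
      simp [hz] at h
      have : p 1 ^ 3 < 0 := Odd.pow_neg (by decide) hy
      linarith
    rw [metric_cubic7 h hz hL]
    by_contra hn
    have h1 : 0 ≤ -p 1 * (v 1 - p 1 * (v 2 / p 2)) ^ 2 :=
      mul_nonneg (neg_nonneg.2 hy.le) (sq_nonneg _)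
    have h2 : v 2 / p 2 = 0 := by nlinarith [sq_nonneg (v 2 / p 2)]
    have h3 : v 2 = 0 := by simpa [hz] using h2
    have h4 : -p 1 * (v 1 - p 1 * (v 2 / p 2)) ^ 2 = 0 := by
      nlinarith [sq_nonneg (v 2 / p 2)]
    have h5 : v 1 = 0 := by simpa [hy.ne, h2] using h4
    refine hv (R3_ext ?_ h5 h3)
    simpa [h5, h3, hz] using hL

/-! ### Sign regions, sign changes and completeness in coordinates -/

/-- The sign `±1` encoded by a Boolean. -/
def sgn (b : Bool) : ℝ := if b then 1 else -1

@[simp] theorem sgn_true : sgn true = 1 := rfl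
@[simp] theorem sgn_false : sgn false = -1 := rfl

@[simp] theorem sgn_mul_self (b : Bool) : sgn b * sgn b = 1 := by cases b <;> simp

@[simp] theorem sgn_sq (b : Bool) : sgn b ^ 2 = 1 := by cases b <;> simp

theorem sgn_mul_sgn_mul (b : Bool) (x : ℝ) : sgn b * (sgn b * x) = x := by
  rw [← mul_assoc, sgn_mul_self, one_mul]

theorem sgn_ne_zero (b : Bool) : sgn b ≠ 0 := by cases b <;> simp

theorem exists_sgn_mul_pos {x : ℝ} (hx : x ≠ 0) : ∃ b, 0 < sgn b * x := by
  rcases lt_or_gt_of_ne hx with h | h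
  · exact ⟨false, by simpa using h⟩
  · exact ⟨true, by simpa using h⟩

theorem sgn_mul_pos_unique {b c : Bool} {x : ℝ} (hb : 0 < sgn b * x) (hc : 0 < sgn c * x) :
    b = c := by
  cases b <;> cases c <;> simp at hb hc <;> first | rfl | linarith

/-- The region on which `f` and `g` have prescribed signs. -/
def quadrant (f g : R3 → ℝ) (i : Bool × Bool) : Set R3 :=
  {p | 0 < sgn i.1 * f p ∧ 0 < sgn i.2 * g p}

theorem isOpen_quadrant {f g : R3 → ℝ} (hf : Continuous f) (hg : Continuous g) (i : Bool × Bool) :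
    IsOpen (quadrant f g i) :=
  (isOpen_lt continuous_const (hf.const_mul _)).inter
    (isOpen_lt continuous_const (hg.const_mul _))

/-- A set on which two continuous functions do not vanish has the four sign regions as components
if these are connected. -/
theorem componentsOf_quadrant {S : Set R3} {f g : R3 → ℝ} (hf : Continuous f) (hg : Continuous g)
    (hS : ∀ p ∈ S, f p ≠ 0 ∧ g p ≠ 0) (hconn : ∀ i, IsConnected (S ∩ quadrant f g i)) :
    componentsOf S = range (fun i => S ∩ quadrant f g i) ∧ (componentsOf S).ncard = 4 := by
  have := componentsOf_eq_range (U := quadrant f g) hconn (isOpen_quadrant hf hg)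
    (fun i j hij => disjoint_left.2 fun p hi hj => hij
      (Prod.ext (sgn_mul_pos_unique hi.1 hj.1) (sgn_mul_pos_unique hi.2 hj.2)))
    (fun i => rfl) (fun p hp => by
      obtain ⟨s, hs⟩ := exists_sgn_mul_pos (hS p hp).1
      obtain ⟨t, ht⟩ := exists_sgn_mul_pos (hS p hp).2
      exact ⟨(s, t), hs, ht⟩)
  simpa using this

theorem range_bool_prod {α : Type*} (A : Bool × Bool → α) :
    range A = {A (false, false), A (false, true), A (true, false), A (true, true)} := by
  ext a
  simp only [mem_range, Prod.exists, Bool.exists_bool, mem_insert_iff, mem_singleton_iff,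
    eq_comm (a := a), or_assoc]

/-- Change of signs of the coordinates. -/
def signChange (e : Fin 3 → Bool) : R3 ≃ₗ[ℝ] R3 :=
  LinearEquiv.ofInvolutive
    { toFun := fun p i => sgn (e i) * p i
      map_add' := fun p q => by ext i; simp [mul_add]
      map_smul' := fun c p => by ext i; simp [mul_left_comm] }
    fun p => by ext i; exact sgn_mul_sgn_mul _ _

theorem linIsomorphic_of_signChange (e : Fin 3 → Bool) {C D : Set R3}
    (H : ∀ p, p ∈ D ↔ (fun i => sgn (e i) * p i) ∈ C) : LinIsomorphic C D := by
  refine ⟨signChange e, ?_⟩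
  ext p
  rw [LinearEquiv.image_eq_preimage_symm, H]
  rfl

/-- The `i`-th coordinate as a linear form. -/
abbrev coord (i : Fin 3) : R3 →L[ℝ] ℝ := ContinuousLinearMap.proj i

theorem IsCubicWith.riemComplete {h : R3 → ℝ} {L N : R3 → R3 → ℝ} (H : IsCubicWith h L N) {n : ℕ}
    (l : Fin n → R3 →L[ℝ] ℝ) {C : Set R3} (hC : ∀ p, p ∈ C ↔ h p = 1 ∧ ∀ i, 0 < l i p)
    (hCh : C ⊆ hyperbolicLocus h) {K : ℝ} (hK : ∀ p ∈ C, ∀ v, L p v = 0 → ∀ i,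
      (l i v) ^ 2 ≤ K ^ 2 * ((l i p) ^ 2 * N p v))
    (hbdd : ∀ M : ℝ, 0 < M → ∃ R : ℝ, ∀ p ∈ C, (∀ i, M⁻¹ ≤ l i p ∧ l i p ≤ M) →
      ∀ j, |p j| ≤ R) :
    RiemComplete h C := by
  refine riemComplete_of_linear H.contDiff H.hom l (Set.ext hC) hCh (K := K) ?_ ?_
  · simpa only [H.fderiv_eq, H.negHessian_eq] using hK
  · intro M hM
    obtain ⟨R, hR⟩ := hbdd M hM
    -- R may be negative if no point satisfies the bounds.
    refine ⟨max R 0, fun p hp hl => (pi_norm_le_iff_of_nonneg (le_max_right _ _)).2 fun j => ?_⟩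
    exact (hR p hp hl j).trans (le_max_left _ _)

theorem one_le_mul_of_inv_le {M a : ℝ} (hM : 0 < M) (h : M⁻¹ ≤ a) : 1 ≤ M * a := by
  rwa [inv_le_iff_one_le_mul₀' hM] at h

/-! ### The cubic xyz -/

theorem isConnected_cubic1 (i : Bool × Bool) :
    IsConnected ({p | cubic1 p = 1} ∩ quadrant (fun p => p 0) (fun p => p 1) i) := by
  obtain ⟨s, t⟩ := i
  have : {p | cubic1 p = 1} ∩ quadrant (fun p => p 0) (fun p => p 1) (s, t) =
      (fun q : ℝ × ℝ => (![sgn s * q.1, sgn t * q.2, sgn s * sgn t / (q.1 * q.2)] : R3)) ''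
        (Ioi 0 ×ˢ Ioi 0) := by
    ext p
    simp only [quadrant, mem_inter_iff, mem_ofPred_eq, mem_image, Prod.exists, mem_prod, mem_Ioi]
    constructor
    · rintro ⟨h, h0, h1⟩
      refine ⟨_, _, ⟨h0, h1⟩, ?_⟩
      simp only [cubic1] at h
      ext j; fin_cases j
      · exact sgn_mul_sgn_mul _ _
      · exact sgn_mul_sgn_mul _ _
      · have h01 := (mul_pos h0 h1).ne'
        simp
        rw [div_eq_iff h01]
        linear_combination (-sgn s * sgn t) * h
    · rintro ⟨a, b, ⟨ha, hb⟩, rfl⟩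
      refine ⟨?_, by simpa [sgn_mul_sgn_mul] using ha, by simpa [sgn_mul_sgn_mul] using hb⟩
      simp [cubic1]
      field_simp
      simp
  rw [this]
  refine (((convex_Ioi 0).prod (convex_Ioi 0)).isConnected ⟨(1, 1), by simp⟩).image _ ?_
  refine continuousOn_pi.2 fun j => ?_
  fin_cases j
  · exact Continuous.continuousOn (by simp; fun_prop)
  · exact Continuous.continuousOn (by simp; fun_prop)
  · refine ContinuousOn.div (by fun_prop) (by fun_prop) fun q hq => ?_
    exact (mul_pos hq.1 hq.2).ne'

/-- By `metric_cubic1` the metric dominates (a/x)² and (b/y)². Bounds on |x| and |y| away from 0 and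
∞ also bound |z| = 1/|xy|, by M². -/
theorem riemComplete_cubic1 (i : Bool × Bool) :
    RiemComplete cubic1 ({p | cubic1 p = 1} ∩ quadrant (fun p => p 0) (fun p => p 1) i) := by
  obtain ⟨s, t⟩ := i
  refine isCubicWith_cubic1.riemComplete ![sgn s • coord 0, sgn t • coord 1] (K := 1)
    (fun p => by simp [quadrant, Fin.forall_fin_two]) (fun p hp => ?_) (fun p hp v hL => ?_)
    (fun M hM => ⟨M + M ^ 2, fun p hp hl => ?_⟩)
  · rw [hyperbolicLocus_cubic1]; exact hp.1
  · have h : p 0 * p 1 * p 2 = 1 := hp.1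
    rw [metric_cubic1 h hL]
    have h0 : p 0 ^ 2 * (p 1 * p 2 * v 0) ^ 2 = v 0 ^ 2 := by
      linear_combination v 0 ^ 2 * (p 0 * p 1 * p 2 + 1) * h
    have h1 : p 1 ^ 2 * (p 0 * p 2 * v 1) ^ 2 = v 1 ^ 2 := by
      linear_combination v 1 ^ 2 * (p 0 * p 1 * p 2 + 1) * h
    simp only [Fin.forall_fin_two]
    constructor
    · simp [mul_pow, sgn_sq]
      nlinarith [sq_nonneg (p 0 * (p 0 * p 2 * v 1)), sq_nonneg (p 0 * (p 0 * p 1 * v 2))]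
    · simp [mul_pow, sgn_sq]
      nlinarith [sq_nonneg (p 1 * (p 1 * p 2 * v 0)), sq_nonneg (p 1 * (p 0 * p 1 * v 2))]
  · have h : p 0 * p 1 * p 2 = 1 := hp.1
    simp only [Fin.forall_fin_two] at hl
    simp at hl
    obtain ⟨⟨h1, h2⟩, h3, h4⟩ := hl
    have hx := one_le_mul_of_inv_le hM h1
    have hy := one_le_mul_of_inv_le hM h3
    have habs : ∀ (b : Bool) (x : ℝ), |x| = |sgn b * x| := fun b x => by cases b <;> simp
    have hx0 : |p 0| ≤ M := by
      rw [habs s, abs_of_pos hp.2.1]; exact h2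
    have hy0 : |p 1| ≤ M := by
      rw [habs t, abs_of_pos hp.2.2]; exact h4
    have hM2 : 0 ≤ M ^ 2 := sq_nonneg M
    rw [Fin.forall_fin_succ, Fin.forall_fin_two]
    refine ⟨by linarith, by simpa using by linarith, ?_⟩
    have hz : |p 0| * |p 1| * |p 2| = 1 := by rw [← abs_mul, ← abs_mul, h, abs_one]
    have hx' : 1 ≤ M * |p 0| := by rw [habs s, abs_of_pos hp.2.1]; exact hx
    have hy' : 1 ≤ M * |p 1| := by rw [habs t, abs_of_pos hp.2.2]; exact hy
    have h5 : 1 ≤ (M * |p 0|) * (M * |p 1|) := one_le_mul_of_one_le_of_one_le hx' hy'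
    have h6 := mul_le_mul_of_nonneg_right h5 (abs_nonneg (p 2))
    have h7 : M * |p 0| * (M * |p 1|) * |p 2| = M ^ 2 := by linear_combination M ^ 2 * hz
    simp
    linarith

/-! ### The cubic x(xy - z²) -/

theorem isConnected_cubic2 : IsConnected {p | cubic2 p = 1 ∧ 0 < p 0} := by
  have : {p | cubic2 p = 1 ∧ 0 < p 0} =
      (fun q : ℝ × ℝ => (![q.1, (1 / q.1 + q.2 ^ 2) / q.1, q.2] : R3)) '' (Ioi 0 ×ˢ univ) := by
    ext p
    simp only [mem_ofPred_eq, mem_image, Prod.exists, mem_prod, mem_Ioi, mem_univ, and_true]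
    constructor
    · rintro ⟨h, h0⟩
      refine ⟨_, p 2, h0, ?_⟩
      simp only [cubic2] at h
      ext j; fin_cases j
      · rfl
      · simp
        field_simp
        linarith
      · rfl
    · rintro ⟨a, b, ha, rfl⟩
      refine ⟨?_, by simpa using ha⟩
      simp [cubic2]
      field_simp
      ring
  rw [this]
  refine (((convex_Ioi 0).prod convex_univ).isConnected ⟨(1, 1), by simp⟩).image _ ?_
  refine continuousOn_pi.2 fun j => ?_
  fin_cases j
  · exact Continuous.continuousOn (by simp; fun_prop)
  · have h0 : ∀ q ∈ (Ioi 0 ×ˢ univ : Set (ℝ × ℝ)), q.1 ≠ 0 := fun q hq => (ne_of_gt hq.1)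
    exact ((continuousOn_const.div (by fun_prop) h0).add (by fun_prop)).div (by fun_prop) h0
  · exact Continuous.continuousOn (by simp; fun_prop)

/-- The forms are x and y, the latter being positive because x²y = 1 + xz². The remaining coordinate
is controlled by z² < xy. -/
theorem riemComplete_cubic2 : RiemComplete cubic2 {p | cubic2 p = 1 ∧ 0 < p 0} := by
  have hpos : ∀ p ∈ {p | cubic2 p = 1 ∧ 0 < p 0}, 0 < p 1 := fun p ⟨h, h0⟩ => by
    simp only [cubic2] at h
    by_contra! hy
    nlinarith [mul_nonneg (sq_nonneg (p 0)) (neg_nonneg.2 hy), mul_nonneg h0.le (sq_nonneg (p 2))]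
  refine isCubicWith_cubic2.riemComplete ![coord 0, coord 1] (K := 2)
    (fun p => ?_) (fun p hp => ?_) (fun p hp v hL => ?_) (fun M hM => ⟨M, fun p hp hl => ?_⟩)
  · simp only [Fin.forall_fin_two]
    exact ⟨fun hp => ⟨hp.1, hp.2, hpos p hp⟩, fun hp => ⟨hp.1, hp.2.1⟩⟩
  · rw [hyperbolicLocus_cubic2]; exact hp
  · have h : p 0 * (p 0 * p 1 - p 2 ^ 2) = 1 := hp.1
    have hx : 0 < p 0 := hp.2
    rw [metric_cubic2 h hL]
    simp only [Fin.forall_fin_two]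
    set i := (p 0)⁻¹ with hi
    have hi0 : 0 < i := inv_pos.2 hx
    have hxi : p 0 * i = 1 := mul_inv_cancel₀ hx.ne'
    have e1 : 6 * v 0 ^ 2 / p 0 ^ 2 = 6 * (v 0 * i) ^ 2 := by rw [hi]; field_simp
    have e2 : 2 * (p 0 * v 2 - p 2 * v 0) ^ 2 / p 0 = 2 * (p 0 * v 2 - p 2 * v 0) ^ 2 * i := by
      rw [hi]; field_simp
    rw [e1, e2]
    set D := p 0 * v 2 - p 2 * v 0 with hD
    have hD0 : 0 ≤ 2 * D ^ 2 * i := by positivity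
    constructor
    · have : p 0 ^ 2 * (6 * (v 0 * i) ^ 2) = 6 * v 0 ^ 2 := by
        linear_combination 6 * v 0 ^ 2 * (p 0 * i + 1) * hxi
      simp
      nlinarith [mul_nonneg (sq_nonneg (p 0)) hD0, sq_nonneg (v 0)]
    · have hy : p 1 = i ^ 2 + p 2 ^ 2 * i := by
        have : p 0 ^ 2 * (p 1 - (i ^ 2 + p 2 ^ 2 * i)) = 0 := by
          linear_combination h - (p 0 * i + 1) * hxi - p 2 ^ 2 * p 0 * hxi
        have := (mul_eq_zero.1 this).resolve_left (by positivity)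
        linarith
      -- b is written through the two diagonal forms D and a/x, so that b² can be compared with y²
      -- times the metric.
      have hb : v 1 = 2 * (p 2 * D * i ^ 2) + (p 2 ^ 2 * i - 2 * i ^ 2) * (v 0 * i) := by
        have : p 0 ^ 2 * (v 1 - (2 * (p 2 * D * i ^ 2)
            + (p 2 ^ 2 * i - 2 * i ^ 2) * (v 0 * i))) = 0 := by
          rw [hy] at hL
          rw [hD, hi]
          rw [hi] at hL
          field_simp at hL ⊢
          linear_combination hL
        have := (mul_eq_zero.1 this).resolve_left (by positivity)
        linarith
      have h1 : v 1 ^ 2 ≤ 2 * (2 * (p 2 * D * i ^ 2)) ^ 2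
          + 2 * ((p 2 ^ 2 * i - 2 * i ^ 2) * (v 0 * i)) ^ 2 := by
        rw [hb]
        nlinarith [sq_nonneg (2 * (p 2 * D * i ^ 2) - (p 2 ^ 2 * i - 2 * i ^ 2) * (v 0 * i))]
      have h2 : (p 2 ^ 2 * i - 2 * i ^ 2) ^ 2 ≤ 4 * p 1 ^ 2 := by
        rw [hy]
        have : 0 ≤ p 2 ^ 2 * i := by positivity
        nlinarith [sq_nonneg i]
      -- Arithmetic-geometric mean inequality for the two summands i² and z²i of y.
      have h3 : 4 * (p 2 ^ 2 * i ^ 3) ≤ p 1 ^ 2 := by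
        rw [hy]; nlinarith [sq_nonneg (i ^ 2 - p 2 ^ 2 * i)]
      have h4 := mul_le_mul_of_nonneg_right h2 (sq_nonneg (v 0 * i))
      have h5 := mul_le_mul_of_nonneg_right h3 hD0
      simp
      nlinarith [mul_nonneg (sq_nonneg (p 1)) (sq_nonneg (v 0 * i)),
        mul_nonneg (sq_nonneg (p 1)) hD0]
  · have h : p 0 * (p 0 * p 1 - p 2 ^ 2) = 1 := hp.1
    have hx : 0 < p 0 := hp.2
    have hy := hpos p hp
    simp only [Fin.forall_fin_two] at hl
    simp at hl
    rw [Fin.forall_fin_succ, Fin.forall_fin_two]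
    refine ⟨by rw [abs_of_pos hx]; exact hl.1.2, ?_, ?_⟩
    · simp; rw [abs_of_pos hy]; exact hl.2.2
    · simp
      refine abs_le_of_sq_le_sq ?_ hM.le
      have h1 : 0 < p 0 * p 1 - p 2 ^ 2 := by
        by_contra! hle
        nlinarith [mul_nonneg hx.le (neg_nonneg.2 hle)]
      nlinarith [mul_le_mul hl.1.2 hl.2.2 hy.le hM.le]

/-! ### The cubic x(yz + x²) -/

theorem isConnected_cubic3 (i : Bool × Bool) : IsConnected
    ({p | cubic3 p = 1 ∧ 4 * p 0 ^ 3 < 1} ∩ quadrant (fun p => p 0) (fun p => p 1) i) := by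
  obtain ⟨s, t⟩ := i
  have : {p | cubic3 p = 1 ∧ 4 * p 0 ^ 3 < 1} ∩ quadrant (fun p => p 0) (fun p => p 1) (s, t) =
      (fun q : ℝ × ℝ => (![q.1, q.2, (1 - q.1 ^ 3) / (q.1 * q.2)] : R3)) ''
        (({x | 0 < sgn s * x} ∩ {x | 4 * x ^ 3 < 1}) ×ˢ {y | 0 < sgn t * y}) := by
    ext p
    simp only [quadrant, mem_inter_iff, mem_ofPred_eq, mem_image, Prod.exists, mem_prod]
    constructor
    · rintro ⟨⟨h, h3⟩, h0, h1⟩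
      refine ⟨p 0, p 1, ⟨⟨h0, h3⟩, h1⟩, ?_⟩
      simp only [cubic3] at h
      ext j; fin_cases j
      · rfl
      · rfl
      · have h0' := right_ne_zero_of_mul h0.ne'
        have h1' := right_ne_zero_of_mul h1.ne'
        simp
        field_simp
        linarith
    · rintro ⟨a, b, ⟨⟨ha, h3⟩, hb⟩, rfl⟩
      refine ⟨⟨?_, by simpa using h3⟩, by simpa using ha, by simpa using hb⟩
      have h0' := right_ne_zero_of_mul ha.ne'
      have h1' := right_ne_zero_of_mul hb.ne'
      simp [cubic3]
      field_simp
      ring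
  rw [this]
  have hconv : ∀ b, Convex ℝ {x : ℝ | 0 < sgn b * x} := fun b =>
    convex_halfSpace_gt (IsLinearMap.isLinearMap_smul (sgn b)) 0
  have hcb : {x : ℝ | 4 * x ^ 3 < 1} = Iio (1 / (4 : ℝ) ^ ((1 : ℝ) / 3)) := by
    ext x; exact lt_inv_cbrt_four_iff.symm
  refine ((((hconv s).inter (hcb ▸ convex_Iio _)).prod (hconv t)).isConnected
    ⟨(sgn s / 2, sgn t), ?_⟩).image _ ?_
  · refine ⟨⟨?_, ?_⟩, ?_⟩
    · show 0 < sgn s * (sgn s / 2)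
      rw [← mul_div_assoc, sgn_mul_self]; norm_num
    · show 4 * (sgn s / 2) ^ 3 < 1
      cases s <;> norm_num
    · simp
  refine continuousOn_pi.2 fun j => ?_
  fin_cases j
  · exact Continuous.continuousOn (by simp; fun_prop)
  · exact Continuous.continuousOn (by simp; fun_prop)
  · refine ContinuousOn.div (by fun_prop) (by fun_prop) fun q hq => ?_
    exact mul_ne_zero (right_ne_zero_of_mul (ne_of_gt hq.1.1)) (right_ne_zero_of_mul (ne_of_gt hq.2))

/-- On the part `x < 0` of `{x(yz + x²) = 1}` the metric dominates `dx² / x²`, `dy² / y²` and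
`dz² / z²`. -/
theorem metric_bounds_cubic3 {x y z a b c : ℝ} (h : x * (y * z + x ^ 2) = 1) (hx : x < 0)
    (hL : (y * z + 3 * x ^ 2) * a + x * z * b + x * y * c = 0) :
    let N := -(6 * x * a ^ 2 + 2 * z * a * b + 2 * y * a * c + 2 * x * b * c)
    a ^ 2 ≤ 4 * (x ^ 2 * N) ∧ b ^ 2 ≤ 4 * (y ^ 2 * N) ∧ c ^ 2 ≤ 4 * (z ^ 2 * N) := by
  have hx3 : 0 < - x ^ 3 := by
    have : 0 < (-x) ^ 3 := pow_pos (neg_pos.2 hx) 3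
    linarith
  have hP : 0 < 1 - x ^ 3 := by linarith
  have hz : z ≠ 0 := by rintro e; rw [e] at h; linarith
  have hy : y ≠ 0 := by rintro e; rw [e] at h; linarith
  rw [metric_cubic3 h hP.ne' hL]
  obtain ⟨u, rfl⟩ : ∃ u, a = u * x := ⟨a / x, by rw [div_mul_cancel₀ _ hx.ne]⟩
  obtain ⟨A, rfl⟩ : ∃ A, b = A * y := ⟨b / y, by rw [div_mul_cancel₀ _ hy]⟩
  obtain ⟨B, rfl⟩ : ∃ B, c = B * z := ⟨c / z, by rw [div_mul_cancel₀ _ hz]⟩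
  rw [mul_div_cancel_right₀ _ hx.ne, mul_div_cancel_right₀ _ hy, mul_div_cancel_right₀ _ hz]
  have hN1 : (A - B) ^ 2 / 2 + 3 / 2 * u ^ 2 ≤ (1 - x ^ 3) * (A - B) ^ 2 / 2
      + 3 / 2 * u ^ 2 * (1 - 4 * x ^ 3) / (1 - x ^ 3) := by
    refine add_le_add ?_ ?_
    · nlinarith [mul_nonneg hx3.le (sq_nonneg (A - B))]
    · rw [le_div_iff₀ hP]
      nlinarith [mul_nonneg hx3.le (sq_nonneg u)]
  -- The tangent equation in the logarithmic differentials u, A, B of x, y, z. As |1 + 2x³| ≤ 2(1 -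
  -- x³) for x < 0, it bounds A + B by u, while the metric controls u and A - B.
  have hsum : (1 - x ^ 3) * (A + B) = -(1 + 2 * x ^ 3) * u := by
    linear_combination hL - (A + B + u) * h
  have hsum2 : (A + B) ^ 2 ≤ 4 * u ^ 2 := by
    have h1 : ((1 - x ^ 3) * (A + B)) ^ 2 ≤ (1 - x ^ 3) ^ 2 * (4 * u ^ 2) := by
      rw [hsum]
      nlinarith [mul_nonneg (mul_nonneg hx3.le (sq_nonneg u)) zero_le_three, sq_nonneg u]
    rw [mul_pow] at h1
    exact le_of_mul_le_mul_left h1 (by positivity)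
  generalize (1 - x ^ 3) * (A - B) ^ 2 / 2 + 3 / 2 * u ^ 2 * (1 - 4 * x ^ 3) / (1 - x ^ 3) = N
    at hN1
  have hbA : A ^ 2 ≤ 4 * N := by nlinarith [sq_nonneg (A + B - (A - B)), sq_nonneg u]
  have hbB : B ^ 2 ≤ 4 * N := by nlinarith [sq_nonneg (A + B + (A - B)), sq_nonneg u]
  have hbc : u ^ 2 ≤ 4 * N := by nlinarith [sq_nonneg (A - B)]
  refine ⟨?_, ?_, ?_⟩
  · linarith [mul_le_mul_of_nonneg_right hbc (sq_nonneg x)]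
  · linarith [mul_le_mul_of_nonneg_right hbA (sq_nonneg y)]
  · linarith [mul_le_mul_of_nonneg_right hbB (sq_nonneg z)]

theorem riemComplete_cubic3 (t : Bool) : RiemComplete cubic3
    ({p | cubic3 p = 1 ∧ 4 * p 0 ^ 3 < 1} ∩
      quadrant (fun p => p 0) (fun p => p 1) (false, t)) := by
  refine isCubicWith_cubic3.riemComplete ![- coord 0, sgn t • coord 1, - sgn t • coord 2] (K := 2)
    (fun p => ?_) (fun p hp => ?_) (fun p hp v hL => ?_) (fun M hM => ⟨M, fun p hp hl => ?_⟩)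
  · rw [Fin.forall_fin_succ, Fin.forall_fin_two]
    simp [quadrant]
    constructor
    · rintro ⟨⟨h, h3⟩, h0, h1⟩
      refine ⟨h, h0, h1, ?_⟩
      simp only [cubic3] at h
      by_contra! hz
      have h3 : 0 < - p 0 ^ 3 := by
        have : 0 < (-p 0) ^ 3 := pow_pos (neg_pos.2 h0) 3
        linarith
      have h4 : p 0 * p 1 * p 2 = (-p 0) * (sgn t * p 1) * -(sgn t * p 2) := by
        linear_combination -p 0 * p 1 * p 2 * sgn_mul_self t
      have h5 : 0 ≤ (-p 0) * (sgn t * p 1) * (sgn t * p 2) :=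
        mul_nonneg (mul_nonneg (neg_nonneg.2 h0.le) h1.le) hz
      linarith
    · rintro ⟨h, h0, h1, h2⟩
      refine ⟨⟨h, ?_⟩, h0, h1⟩
      have : 0 < (-p 0) ^ 3 := pow_pos (neg_pos.2 h0) 3
      linarith
  · rw [hyperbolicLocus_cubic3_eq]; exact hp.1
  · have h : p 0 * (p 1 * p 2 + p 0 ^ 2) = 1 := hp.1.1
    have hx : p 0 < 0 := by simpa [quadrant] using hp.2.1
    have hb := metric_bounds_cubic3 h hx hL
    rw [Fin.forall_fin_succ, Fin.forall_fin_two]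
    simp only [mul_pow, Matrix.cons_val_zero, Matrix.cons_val_succ, Matrix.cons_val_one,
      neg_apply, smul_apply, ContinuousLinearMap.proj_apply, smul_eq_mul, neg_mul, neg_sq,
      sgn_sq, one_mul]
    norm_num
    simpa using hb
  · rw [Fin.forall_fin_succ, Fin.forall_fin_two] at hl ⊢
    simp at hl ⊢
    have hMi : 0 < M⁻¹ := inv_pos.2 hM
    obtain ⟨h0, h1, h2⟩ := hl
    refine ⟨abs_le.2 ⟨by linarith, by linarith⟩, ?_, ?_⟩
    · cases t <;> simp at h1 <;> exact abs_le.2 ⟨by linarith, by linarith⟩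
    · cases t <;> simp at h2 <;> exact abs_le.2 ⟨by linarith, by linarith⟩

theorem IsCubicWith.not_riemComplete {h : R3 → ℝ} {L N : R3 → R3 → ℝ} (H : IsCubicWith h L N)
    {C U : Set R3} (hU : IsOpen U) (hC : ∀ p, p ∈ C ↔ h p = 1 ∧ p ∈ U)
    (hCh : C ⊆ hyperbolicLocus h) {σ : ℝ → R3} (hσ : ∀ i, ContDiffOn ℝ 1 (fun t => σ t i) (Icc 0 1))
    (hσC : ∀ t ∈ Ioc (0 : ℝ) 1, σ t ∈ C) (hσ0 : σ 0 ∉ C) : ¬ RiemComplete h C :=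
  not_riemComplete_of_curve H.contDiff hU (Set.ext hC) hCh (contDiffOn_pi.2 hσ) hσC hσ0

theorem not_riemComplete_cubic3 (t : Bool) : ¬ RiemComplete cubic3
    ({p | cubic3 p = 1 ∧ 4 * p 0 ^ 3 < 1} ∩
      quadrant (fun p => p 0) (fun p => p 1) (true, t)) := by
  -- For x > 0 the boundary 4x³ = 1 is reached: the curve starts at x = r with y = ±1 and moves
  -- towards smaller x.
  obtain ⟨r, hr, hr3⟩ : ∃ r : ℝ, 0 < r ∧ 4 * r ^ 3 = 1 := by
    refine ⟨(1 / 4 : ℝ) ^ ((1 : ℝ) / 3), by positivity, ?_⟩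
    rw [← Real.rpow_natCast, ← Real.rpow_mul (by norm_num)]; norm_num
  have hσpos : ∀ τ ∈ Icc (0 : ℝ) 1, 0 < r * (1 - τ / 2) := fun τ hτ =>
    mul_pos hr (by linarith [hτ.2])
  refine isCubicWith_cubic3.not_riemComplete
    (U := {p | 4 * p 0 ^ 3 < 1} ∩ quadrant (fun p => p 0) (fun p => p 1) (true, t))
    (σ := fun τ => ![r * (1 - τ / 2), sgn t,
      (1 - (r * (1 - τ / 2)) ^ 3) / (r * (1 - τ / 2) * sgn t)])
    ((isOpen_lt (by fun_prop) continuous_const).inter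
      (isOpen_quadrant (by fun_prop) (by fun_prop) _))
    (fun p => and_assoc) (fun p hp => ?_) (fun i => ?_) (fun τ hτ => ?_) (fun h0 => ?_)
  · rw [hyperbolicLocus_cubic3_eq]; exact hp.1
  · fin_cases i
    · exact ContDiff.contDiffOn (by simp; fun_prop)
    · exact ContDiff.contDiffOn (by simp; fun_prop)
    · refine ContDiffOn.div (by fun_prop) (by fun_prop) fun τ hτ => ?_
      exact mul_ne_zero (hσpos τ hτ).ne' (sgn_ne_zero t)
  · have hp := hσpos τ (Ioc_subset_Icc_self hτ)
    have ht := sgn_ne_zero t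
    refine ⟨⟨?_, ?_⟩, by simpa [quadrant] using hp⟩
    · set X := r * (1 - τ / 2)
      have hX := hp.ne'
      change cubic3 _ = 1
      simp [cubic3]
      field_simp
      ring
    · show 4 * (r * (1 - τ / 2)) ^ 3 < 1
      have h1 : 1 - τ / 2 < 1 := by linarith [hτ.1]
      have h2 : (1 - τ / 2) ^ 3 < 1 := pow_lt_one₀ (by linarith [hτ.2]) h1 (by norm_num)
      rw [mul_pow, ← mul_assoc, hr3, one_mul]; exact h2
  · have : 4 * (r * (1 - 0 / 2)) ^ 3 < 1 := h0.1.2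
    simp at this
    linarith

/-! ### The cubic z(x² + y² - z²) -/

theorem sq_lt_of_cubic4 {p : R3} (h : cubic4 p = 1) (hz : p 2 < 0) :
    p 0 ^ 2 + p 1 ^ 2 < p 2 ^ 2 := by
  simp only [cubic4] at h
  by_contra! hle
  nlinarith [mul_nonneg (neg_nonneg.2 hz.le) (sub_nonneg.2 hle)]

/-- The surface is the radial image of the cone z < 0, x² + y² < z². The cone is convex and h > 0 on
it, so the segment from (0, 0, -1) to any point projects to a path in the surface. -/
theorem isConnected_cubic4 : IsConnected {p | cubic4 p = 1 ∧ p 2 < 0} := by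
  have h0 : (![0, 0, -1] : R3) ∈ {p | cubic4 p = 1 ∧ p 2 < 0} := by
    constructor
    · simp [cubic4]
    · simp
  refine ⟨⟨_, h0⟩, isPreconnected_of_forall ![0, 0, -1] fun q hq => ?_⟩
  have hq2 := sq_lt_of_cubic4 hq.1 hq.2
  have hqz : q 2 < 0 := hq.2
  set g : ℝ → R3 := fun t => (1 - t) • (![0, 0, -1] : R3) + t • q with hg
  have g0 : ∀ t, g t 0 = t * q 0 := fun t => by
    change (1 - t) * 0 + t * q 0 = _; ring
  have g1 : ∀ t, g t 1 = t * q 1 := fun t => by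
    change (1 - t) * 0 + t * q 1 = _; ring
  have g2 : ∀ t, g t 2 = t - 1 + t * q 2 := fun t => by
    change (1 - t) * -1 + t * q 2 = _; ring
  have hgz : ∀ t ∈ Icc (0 : ℝ) 1, g t 2 < 0 := by
    intro t ht
    rw [g2]
    rcases ht.1.eq_or_lt with rfl | h
    · simp
    · nlinarith [ht.2, mul_pos h (neg_pos.2 hqz)]
  have hgpos : ∀ t ∈ Icc (0 : ℝ) 1, 0 < cubic4 (g t) := by
    intro t ht
    have hz := hgz t ht
    refine mul_pos_of_neg_of_neg hz ?_
    rw [g0, g1, g2]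
    have h1 : 0 ≤ 1 - t := by linarith [ht.2]
    have h2 : 0 ≤ (1 - t) * (t * -q 2) := mul_nonneg h1 (mul_nonneg ht.1 (by linarith))
    have h3 : t ^ 2 * (q 0 ^ 2 + q 1 ^ 2) ≤ t ^ 2 * q 2 ^ 2 :=
      mul_le_mul_of_nonneg_left hq2.le (sq_nonneg t)
    rcases h1.eq_or_lt with h4 | h4
    · have : t = 1 := by linarith
      subst this
      simp; linarith
    · nlinarith [mul_pos h4 h4]
  have hgc : Continuous g := by fun_prop
  refine ⟨(fun t => rayProj cubic4 (g t)) '' Icc 0 1, ?_, ⟨0, by simp, ?_⟩, ⟨1, by simp, ?_⟩, ?_⟩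
  · rintro _ ⟨t, ht, rfl⟩
    refine ⟨apply_rayProj isCubicWith_cubic4.hom (hgpos t ht), ?_⟩
    exact mul_neg_of_pos_of_neg (Real.rpow_pos_of_pos (hgpos t ht) _) (hgz t ht)
  · have : g 0 = ![0, 0, -1] := by simp [hg]
    simp only [this]
    exact rayProj_eq_self h0.1
  · have : g 1 = q := by rw [hg]; simp only [sub_self, zero_smul, one_smul, zero_add]
    simp only [this]
    exact rayProj_eq_self hq.1
  · refine isPreconnected_Icc.image _ fun t ht => ContinuousAt.continuousWithinAt ?_
    exact (contDiffAt_rayProj isCubicWith_cubic4.contDiff (hgpos t ht)).continuousAt.comp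
      hgc.continuousAt

theorem riemComplete_cubic4 : RiemComplete cubic4 {p | cubic4 p = 1 ∧ p 2 < 0} := by
  refine isCubicWith_cubic4.riemComplete ![-coord 2] (K := 1)
    (fun p => by simp) (fun p hp => ?_) (fun p hp v hL => ?_) (fun M hM => ⟨M, fun p hp hl => ?_⟩)
  · rw [hyperbolicLocus_cubic4]; exact hp
  · simpa using metric_cubic4 hp.1 hp.2 hL
  · have h := sq_lt_of_cubic4 hp.1 hp.2
    simp at hl
    have hz : p 2 < 0 := hp.2
    have h2 : p 2 ^ 2 ≤ M ^ 2 := by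
      rw [← neg_sq]; exact pow_le_pow_left₀ (by linarith) hl.2 2
    rw [Fin.forall_fin_succ, Fin.forall_fin_two]
    refine ⟨abs_le_of_sq_le_sq (by nlinarith [sq_nonneg (p 1)]) hM.le,
      abs_le_of_sq_le_sq ?_ hM.le, abs_le_of_sq_le_sq h2 hM.le⟩
    simp
    nlinarith [sq_nonneg (p 0)]

/-! ### The cubic x(y² - z²) + y³ -/

/-- The locus of the fifth cubic. -/
def locus5 : Set R3 :=
  {p | cubic5 p = 1 ∧ p 1 ^ 2 - p 2 ^ 2 ≠ 0 ∧ p 1 * (p 1 ^ 2 + 3 * p 2 ^ 2) < 1}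

/-- With f = y - z and g = y + z one has 2y(y² + 3z²) = f³ + g³, so the cubes |f|³ and |g|³ range
over the part of the open quadrant in a half-plane, which is convex. The coordinate x is determined
by y and z. -/
theorem isConnected_cubic5 (i : Bool × Bool) : IsConnected
    (locus5 ∩ quadrant (fun p => p 1 - p 2) (fun p => p 1 + p 2) i) := by
  obtain ⟨s, t⟩ := i
  have hcb : ∀ a : ℝ, 0 < a → (a ^ (1 / 3 : ℝ)) ^ 3 = a := fun a ha => by
    rw [← Real.rpow_natCast, ← Real.rpow_mul ha.le]; norm_num
  have hs3 : ∀ b, sgn b ^ 3 = sgn b := fun b => by cases b <;> norm_num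
  have : locus5 ∩ quadrant (fun p => p 1 - p 2) (fun p => p 1 + p 2) (s, t) =
      (fun q : ℝ × ℝ => (![(1 - ((sgn s * q.1 + sgn t * q.2) / 2) ^ 3) /
          ((sgn s * q.1) * (sgn t * q.2)),
          (sgn s * q.1 + sgn t * q.2) / 2, (sgn t * q.2 - sgn s * q.1) / 2] : R3)) ''
        ((fun q : ℝ × ℝ => (q.1 ^ (1 / 3 : ℝ), q.2 ^ (1 / 3 : ℝ))) ''
          ((Ioi 0 ×ˢ Ioi 0) ∩ {q | sgn s * q.1 + sgn t * q.2 < 2})) := by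
    ext p
    simp only [quadrant, mem_inter_iff, mem_ofPred_eq, mem_image, Prod.exists, mem_prod, mem_Ioi,
      Prod.mk.injEq]
    constructor
    · rintro ⟨⟨h, hq, h3⟩, h0, h1⟩
      have hroot : ∀ a : ℝ, 0 < a → (a ^ 3) ^ (1 / 3 : ℝ) = a := fun a ha => by
        rw [← Real.rpow_natCast, ← Real.rpow_mul ha.le]; norm_num
      refine ⟨_, _, ⟨(sgn s * (p 1 - p 2)) ^ 3, (sgn t * (p 1 + p 2)) ^ 3,
        ⟨⟨pow_pos h0 3, pow_pos h1 3⟩, ?_⟩, hroot _ h0, hroot _ h1⟩, ?_⟩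
      · rw [mul_pow, mul_pow, hs3, hs3, sgn_mul_sgn_mul, sgn_mul_sgn_mul]
        linarith
      · simp only [cubic5] at h
        simp only [sgn_mul_sgn_mul]
        have hq' : (p 1 - p 2) * (p 1 + p 2) ≠ 0 := by
          contrapose! hq; linarith
        ext j; fin_cases j
        · simp
          rw [div_eq_iff hq']
          linear_combination -h
        · simp
        · simp
    · rintro ⟨a, b, ⟨u, w, ⟨⟨hu, hw⟩, h2⟩, rfl, rfl⟩, rfl⟩
      have hu' := Real.rpow_pos_of_pos hu (1 / 3)
      have hw' := Real.rpow_pos_of_pos hw (1 / 3)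
      have hu3 := hcb u hu
      have hw3 := hcb w hw
      generalize u ^ (1 / 3 : ℝ) = a at *
      generalize w ^ (1 / 3 : ℝ) = b at *
      have hs := sgn_ne_zero s
      have ht := sgn_ne_zero t
      have hdiff : (sgn s * a + sgn t * b) / 2 - (sgn t * b - sgn s * a) / 2 = sgn s * a := by ring
      have hadd : (sgn s * a + sgn t * b) / 2 + (sgn t * b - sgn s * a) / 2 = sgn t * b := by ring
      have hprod : ((sgn s * a + sgn t * b) / 2) ^ 2 - ((sgn t * b - sgn s * a) / 2) ^ 2
        = sgn s * a * (sgn t * b) := by ring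
      have hne : sgn s * a * (sgn t * b) ≠ 0 :=
        mul_ne_zero (mul_ne_zero hs hu'.ne') (mul_ne_zero ht hw'.ne')
      refine ⟨⟨?_, ?_, ?_⟩, ?_, ?_⟩
      · simp [cubic5, hprod]
        rw [div_mul_cancel₀ _ hne]; ring
      · simpa [hprod] using hne
      · have h3 : (sgn s * a) ^ 3 + (sgn t * b) ^ 3 < 2 := by
          rw [mul_pow, mul_pow, hs3, hs3, hu3, hw3]; exact h2
        simp
        linarith
      · simpa [hdiff, sgn_mul_sgn_mul] using hu'
      · simpa [hadd, sgn_mul_sgn_mul] using hw'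
  rw [this]
  have hlin : IsLinearMap ℝ fun q : ℝ × ℝ => sgn s * q.1 + sgn t * q.2 :=
    ⟨fun p q => by simp; ring, fun c p => by simp; ring⟩
  refine (((((convex_Ioi 0).prod (convex_Ioi 0)).inter (convex_halfSpace_lt hlin 2)).isConnected
    ⟨(1 / 2, 1 / 2), ?_⟩).image _ ?_).image _ ?_
  · refine ⟨by simp, ?_⟩
    cases s <;> cases t <;> norm_num
  · exact ((continuous_fst.rpow_const (by simp)).prodMk
      (continuous_snd.rpow_const (by simp))).continuousOn
  · refine continuousOn_pi.2 fun j => ?_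
    fin_cases j
    · refine ContinuousOn.div (by fun_prop) (by fun_prop) fun q hq => ?_
      obtain ⟨r, ⟨hr, -⟩, rfl⟩ := hq
      have hu' := Real.rpow_pos_of_pos hr.1 (1 / 3)
      have hw' := Real.rpow_pos_of_pos hr.2 (1 / 3)
      exact mul_ne_zero (mul_ne_zero (sgn_ne_zero s) hu'.ne')
        (mul_ne_zero (sgn_ne_zero t) hw'.ne')
    · exact Continuous.continuousOn (by simp; fun_prop)
    · exact Continuous.continuousOn (by simp; fun_prop)

/-- Here y < 0, so the boundary y(y² + 3z²) = 1 is out of reach and the second coefficient in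
`metric_cubic5` is at least 2. With m = yb - zc and k = zb - yc, the logarithmic differentials of y
- z and y + z are (m ± k)/(y² - z²), hence dominated by the metric. -/
theorem riemComplete_cubic5 : RiemComplete cubic5
    (locus5 ∩ quadrant (fun p => p 1 - p 2) (fun p => p 1 + p 2) (false, false)) := by
  refine isCubicWith_cubic5.riemComplete ![coord 2 - coord 1, -coord 1 - coord 2] (K := 1)
    (fun p => ?_) (fun p hp => ?_) (fun p hp v hL => ?_)
    (fun M hM => ⟨M + (1 + M ^ 3) * M ^ 2, fun p hp hl => ?_⟩)
  · simp only [Fin.forall_fin_two]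
    simp [quadrant, locus5]
    constructor
    · rintro ⟨⟨h, hq, h3⟩, h0, h1⟩
      exact ⟨h, by linarith, by linarith⟩
    · rintro ⟨h, h0, h1⟩
      have h2 : 0 < (p 2 - p 1) * (-p 1 - p 2) := mul_pos (by linarith) (by linarith)
      refine ⟨⟨h, ?_, ?_⟩, by linarith, by linarith⟩
      · intro e; linarith
      · have hy : p 1 < 0 := by linarith
        have : 0 ≤ -p 1 * (p 1 ^ 2 + 3 * p 2 ^ 2) :=
          mul_nonneg (by linarith) (by positivity)
        linarith
  · rw [hyperbolicLocus_cubic5]; exact hp.1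
  · have hq := hp.1.2.1
    have hN := metric_cubic5 hp.1.1 hq hL
    have hpos : 0 ≤ 2 * -(p 1 * (p 1 ^ 2 + 3 * p 2 ^ 2)) := by
      have h0 : p 1 - p 2 < 0 := by simpa [quadrant] using hp.2.1
      have h1 : p 1 + p 2 < 0 := by
        have := hp.2.2
        simp at this
        linarith
      have : 0 ≤ -p 1 * (p 1 ^ 2 + 3 * p 2 ^ 2) :=
        mul_nonneg (by linarith) (by positivity)
      linarith
    generalize -(2 * p 0 * (v 1 ^ 2 - v 2 ^ 2) + 4 * v 0 * (p 1 * v 1 - p 2 * v 2)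
      + 6 * p 1 * v 1 ^ 2) = N at *
    have hk := mul_nonneg hpos (sq_nonneg (p 2 * v 1 - p 1 * v 2))
    set m := p 1 * v 1 - p 2 * v 2 with hm
    set k := p 2 * v 1 - p 1 * v 2 with hkk
    have hge : (2 * m ^ 2 + 2 * k ^ 2) ≤ (p 1 ^ 2 - p 2 ^ 2) ^ 2 * N := by
      rw [hN]; nlinarith [sq_nonneg m]
    have hq' : (p 1 - p 2) * (p 1 + p 2) ≠ 0 := by
      contrapose! hq; linarith
    have hf := left_ne_zero_of_mul hq'
    have hg := right_ne_zero_of_mul hq'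
    simp only [Fin.forall_fin_two]
    simp
    constructor
    · have h1 : (p 1 + p 2) ^ 2 * (v 2 - v 1) ^ 2 ≤
          (p 1 + p 2) ^ 2 * ((p 2 - p 1) ^ 2 * N) := by
        have : (p 1 + p 2) ^ 2 * (v 2 - v 1) ^ 2 = (m + k) ^ 2 := by rw [hm, hkk]; ring
        rw [this]
        nlinarith [sq_nonneg (m - k)]
      exact le_of_mul_le_mul_left h1 (by positivity)
    · have h1 : (p 1 - p 2) ^ 2 * (-v 1 - v 2) ^ 2 ≤
          (p 1 - p 2) ^ 2 * ((-p 1 - p 2) ^ 2 * N) := by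
        have : (p 1 - p 2) ^ 2 * (-v 1 - v 2) ^ 2 = (m - k) ^ 2 := by rw [hm, hkk]; ring
        rw [this]
        nlinarith [sq_nonneg (m + k)]
      exact le_of_mul_le_mul_left h1 (by positivity)
  · have h : p 0 * (p 1 ^ 2 - p 2 ^ 2) + p 1 ^ 3 = 1 := hp.1.1
    simp only [Fin.forall_fin_two] at hl
    simp at hl
    obtain ⟨⟨h1, h2⟩, h3, h4⟩ := hl
    have hf := one_le_mul_of_inv_le hM h1
    have hg := one_le_mul_of_inv_le hM h3
    have hMi : 0 < M⁻¹ := inv_pos.2 hM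
    have hR : 0 ≤ (1 + M ^ 3) * M ^ 2 := by positivity
    have hy : |p 1| ≤ M := abs_le.2 ⟨by linarith, by linarith⟩
    have hz : |p 2| ≤ M := abs_le.2 ⟨by linarith, by linarith⟩
    rw [Fin.forall_fin_succ, Fin.forall_fin_two]
    refine ⟨?_, by simp; linarith, by simp; linarith⟩
    -- A lower bound for |y² - z²| bounds x = (1 - y³)/(y² - z²).
    have hq1 : 1 ≤ M ^ 2 * |p 1 ^ 2 - p 2 ^ 2| := by
      have h5 := one_le_mul_of_one_le_of_one_le hf hg
      have h6 : M * (p 2 - p 1) * (M * (-p 1 - p 2)) = M ^ 2 * (p 1 ^ 2 - p 2 ^ 2) := by ring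
      rw [h6] at h5
      exact h5.trans (mul_le_mul_of_nonneg_left (le_abs_self _) (sq_nonneg M))
    have h7 : |p 0| * |p 1 ^ 2 - p 2 ^ 2| ≤ 1 + M ^ 3 := by
      rw [← abs_mul, show p 0 * (p 1 ^ 2 - p 2 ^ 2) = 1 - p 1 ^ 3 by linarith]
      refine (abs_sub _ _).trans ?_
      rw [abs_one, abs_pow]
      gcongr
    have h8 := mul_le_mul_of_nonneg_left hq1 (abs_nonneg (p 0))
    have h9 := mul_le_mul_of_nonneg_right h7 (sq_nonneg M)
    nlinarith

/-- A sign region of the fifth locus containing a boundary point with `(y - ez)³ + (y + ez)³ = 2`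
is incomplete. -/
theorem not_riemComplete_cubic5 {e f g : ℝ} (he : e * e = 1) (hf : 0 < f) (hg : g ≠ 0)
    (hfg : f ^ 3 + g ^ 3 = 2) : ¬ RiemComplete cubic5
      (locus5 ∩ {p | 0 < p 1 - e * p 2 ∧ 0 < g * (p 1 + e * p 2)}) := by
  have hpos : ∀ τ ∈ Icc (0 : ℝ) 1, 0 < f * (1 - τ / 2) := fun τ hτ =>
    mul_pos hf (by linarith [hτ.2])
  have hopen : IsOpen {p : R3 | p 1 * (p 1 ^ 2 + 3 * p 2 ^ 2) < 1} :=
    isOpen_lt (by fun_prop) continuous_const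
  have hopen1 : IsOpen {p : R3 | p 1 ^ 2 - p 2 ^ 2 ≠ 0} :=
    isOpen_ne_fun (by fun_prop) continuous_const
  have hopen2 : IsOpen {p : R3 | 0 < p 1 - e * p 2} :=
    isOpen_lt continuous_const (by fun_prop)
  have hopen3 : IsOpen {p : R3 | 0 < g * (p 1 + e * p 2)} :=
    isOpen_lt continuous_const (by fun_prop)
  refine isCubicWith_cubic5.not_riemComplete
    (U := ({p | p 1 ^ 2 - p 2 ^ 2 ≠ 0} ∩ {p | p 1 * (p 1 ^ 2 + 3 * p 2 ^ 2) < 1}) ∩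
      ({p | 0 < p 1 - e * p 2} ∩ {p | 0 < g * (p 1 + e * p 2)}))
    (σ := fun τ => ![(1 - ((f * (1 - τ / 2) + g) / 2) ^ 3) / (f * (1 - τ / 2) * g),
      (f * (1 - τ / 2) + g) / 2, e * ((g - f * (1 - τ / 2)) / 2)])
    ((hopen1.inter hopen).inter (hopen2.inter hopen3))
    (fun p => and_assoc) (fun p hp => ?_) (fun i => ?_) (fun τ hτ => ?_) (fun h0 => ?_)
  · rw [hyperbolicLocus_cubic5]; exact hp.1
  · fin_cases i
    · refine ContDiffOn.div (by fun_prop) (by fun_prop) fun τ hτ => ?_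
      exact mul_ne_zero (hpos τ hτ).ne' hg
    · exact ContDiff.contDiffOn (by simp; fun_prop)
    · exact ContDiff.contDiffOn (by simp; fun_prop)
  · have hF := hpos τ (Ioc_subset_Icc_self hτ)
    -- Shrinking f while g stays fixed brings f³ + g³ = 2y(y² + 3z²) below 2, that is, into the
    -- locus.
    have hF3 : (f * (1 - τ / 2)) ^ 3 < f ^ 3 :=
      pow_lt_pow_left₀ (by nlinarith [hτ.1]) hF.le (by norm_num)
    generalize f * (1 - τ / 2) = F at *
    have hez : (e * ((g - F) / 2)) ^ 2 = ((g - F) / 2) ^ 2 := by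
      rw [mul_pow, pow_two e, he, one_mul]
    have hez1 : e * (e * ((g - F) / 2)) = (g - F) / 2 := by rw [← mul_assoc, he, one_mul]
    have hq : ((F + g) / 2) ^ 2 - ((g - F) / 2) ^ 2 = F * g := by ring
    refine ⟨⟨?_, ?_, ?_⟩, ?_, ?_⟩
    · simp [cubic5, hez, hq]
      rw [div_mul_cancel₀ _ (mul_ne_zero hF.ne' hg)]; ring
    · simp [hez, hq, hF.ne', hg]
    · simp [hez]
      linarith
    · simp [hez1]
      linarith
    · have : 0 < g ^ 2 := by positivity
      simp [hez1]
      linarith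
  · have h3 := h0.1.2.2
    have hez : (e * ((g - f) / 2)) ^ 2 = ((g - f) / 2) ^ 2 := by
      rw [mul_pow, pow_two e, he, one_mul]
    simp [hez] at h3
    linarith

/-! ### The cubic x(y² + z²) + y³ -/

/-- The locus of the sixth cubic. -/
def locus6 : Set R3 := {p | cubic6 p = 1 ∧ 1 < p 1 * (p 1 ^ 2 - 3 * p 2 ^ 2)}

theorem isOpen_cubic6_ineq : IsOpen {p : R3 | 1 < p 1 * (p 1 ^ 2 - 3 * p 2 ^ 2)} :=
  isOpen_lt continuous_const (by fun_prop)

theorem cubic6_eq_one_iff {x y z : ℝ} (h : y ≠ 0) :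
    cubic6 ![x, y, z] = 1 ↔ x = (1 - y ^ 3) / (y ^ 2 + z ^ 2) := by
  have : y ^ 2 + z ^ 2 ≠ 0 := by positivity
  simp only [cubic6]
  rw [eq_div_iff this]
  simp
  constructor <;> intro h <;> linarith

theorem R3_eta (p : R3) : ![p 0, p 1, p 2] = p := by
  ext j; fin_cases j <;> rfl

/-- For y > 0 the inequality means y > 1 and z² < (y³ - 1)/(3y); rescaling z by the square root of
this bound gives a product of intervals. -/
theorem isConnected_cubic6_pos : IsConnected (locus6 ∩ {p | 0 < p 1}) := by
  have : locus6 ∩ {p | 0 < p 1} =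
      (fun q : ℝ × ℝ => (![(1 - q.1 ^ 3) / (q.1 ^ 2 + q.2 ^ 2), q.1, q.2] : R3)) ''
      ((fun q : ℝ × ℝ => (q.1, q.2 * Real.sqrt ((q.1 ^ 3 - 1) / (3 * q.1)))) ''
        (Ioi 1 ×ˢ Ioo (-1) 1)) := by
    ext p
    simp only [mem_inter_iff, mem_ofPred_eq, mem_image, Prod.exists, mem_prod, mem_Ioi,
      Prod.mk.injEq]
    constructor
    · rintro ⟨⟨h, h3⟩, hy⟩
      have hy1 : 1 < p 1 := by
        have h1 : 0 ≤ p 1 * (3 * p 2 ^ 2) := by positivity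
        have h2 : (1 : ℝ) ^ 3 < p 1 ^ 3 := by linarith
        exact lt_of_pow_lt_pow_left₀ 3 hy.le h2
      have hw : 0 < (p 1 ^ 3 - 1) / (3 * p 1) :=
        div_pos (sub_pos.2 (one_lt_pow₀ hy1 (by norm_num))) (by linarith)
      have hzw : p 2 ^ 2 < (p 1 ^ 3 - 1) / (3 * p 1) := by
        rw [lt_div_iff₀ (by linarith)]; linarith
      have hs := Real.sqrt_pos.2 hw
      have habs := abs_lt_of_sq_lt_sq (hzw.trans_eq (Real.sq_sqrt hw.le).symm) hs.le
      refine ⟨_, _, ⟨p 1, p 2 / Real.sqrt ((p 1 ^ 3 - 1) / (3 * p 1)), ⟨hy1, ?_⟩, rfl, rfl⟩, ?_⟩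
      · rw [mem_Ioo, lt_div_iff₀ hs, div_lt_iff₀ hs]
        have := abs_lt.1 habs
        constructor <;> linarith
      · rw [div_mul_cancel₀ _ hs.ne']
        rw [← R3_eta p, cubic6_eq_one_iff hy.ne'] at h
        rw [← h, R3_eta]
    · rintro ⟨a, b, ⟨y, τ, ⟨hy, hτ⟩, rfl, rfl⟩, rfl⟩
      have hy0 : 0 < y := by linarith
      have hw : 0 < (y ^ 3 - 1) / (3 * y) :=
        div_pos (sub_pos.2 (one_lt_pow₀ hy (by norm_num))) (by linarith)
      refine ⟨⟨(cubic6_eq_one_iff hy0.ne').2 rfl, ?_⟩, by simpa using hy0⟩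
      have hτ2 : τ ^ 2 < 1 := by
        rw [sq_lt_one_iff_abs_lt_one]; exact abs_lt.2 hτ
      simp
      rw [mul_pow, Real.sq_sqrt hw.le]
      have h1 : y * (y ^ 2 - 3 * (τ ^ 2 * ((y ^ 3 - 1) / (3 * y)))) =
          1 + (y ^ 3 - 1) * (1 - τ ^ 2) := by field_simp; ring
      rw [h1]
      have := mul_pos (sub_pos.2 (one_lt_pow₀ hy (three_ne_zero))) (sub_pos.2 hτ2)
      linarith
  rw [this]
  refine ((((convex_Ioi 1).prod (convex_Ioo _ _)).isConnected ⟨(2, 0), by simp⟩).image _ ?_).image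
    _ ?_
  · refine ContinuousOn.prodMk (by fun_prop) (ContinuousOn.mul (by fun_prop) ?_)
    refine ContinuousOn.sqrt (ContinuousOn.div (by fun_prop) (by fun_prop) fun q hq => ?_)
    have : (1 : ℝ) < q.1 := hq.1
    positivity
  · refine continuousOn_pi.2 fun j => ?_
    fin_cases j
    · refine ContinuousOn.div (by fun_prop) (by fun_prop) fun q hq => ?_
      obtain ⟨r, hr, rfl⟩ := hq
      have : (1 : ℝ) < r.1 := hr.1
      positivity
    · exact Continuous.continuousOn (by simp; fun_prop)
    · exact Continuous.continuousOn (by simp; fun_prop)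

/-- Dividing by 3y < 0 reverses the inequality to z² > (y³ - 1)/(3y) > 0, which splits the region by
the sign of z. The excess of |z| over the square root is a free positive parameter. -/
theorem isConnected_cubic6_neg (s : Bool) :
    IsConnected (locus6 ∩ {p | p 1 < 0 ∧ 0 < sgn s * p 2}) := by
  have : locus6 ∩ {p | p 1 < 0 ∧ 0 < sgn s * p 2} =
      (fun q : ℝ × ℝ => (![(1 - q.1 ^ 3) / (q.1 ^ 2 + q.2 ^ 2), q.1, q.2] : R3)) ''
      ((fun q : ℝ × ℝ => (q.1, sgn s * (Real.sqrt ((q.1 ^ 3 - 1) / (3 * q.1)) + q.2))) ''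
        (Iio 0 ×ˢ Ioi 0)) := by
    have hw : ∀ y : ℝ, y < 0 → 0 < (y ^ 3 - 1) / (3 * y) := fun y hy => by
      refine div_pos_of_neg_of_neg ?_ (by linarith)
      have : y ^ 3 < 0 := Odd.pow_neg (by decide) hy
      linarith
    ext p
    simp only [mem_inter_iff, mem_ofPred_eq, mem_image, Prod.exists, mem_prod, mem_Ioi,
      Prod.mk.injEq, mem_Iio]
    constructor
    · rintro ⟨⟨h, h3⟩, hy, hz⟩
      refine ⟨_, _, ⟨p 1, sgn s * p 2 - Real.sqrt ((p 1 ^ 3 - 1) / (3 * p 1)), ⟨hy, ?_⟩, rfl, rfl⟩,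
        ?_⟩
      · rw [sub_pos, Real.sqrt_lt' hz, mul_pow, sgn_sq, one_mul, div_lt_iff_of_neg (by linarith)]
        linarith
      · rw [add_sub_cancel, sgn_mul_sgn_mul]
        rw [← R3_eta p, cubic6_eq_one_iff hy.ne] at h
        rw [← h, R3_eta]
    · rintro ⟨a, b, ⟨y, τ, ⟨hy, hτ⟩, rfl, rfl⟩, rfl⟩
      refine ⟨⟨(cubic6_eq_one_iff hy.ne).2 rfl, ?_⟩, by simpa using hy, ?_⟩
      · have h1 : (y ^ 3 - 1) / (3 * y) < (Real.sqrt ((y ^ 3 - 1) / (3 * y)) + τ) ^ 2 := by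
          rw [← Real.sqrt_lt' (by positivity)]; linarith
        rw [div_lt_iff_of_neg (by linarith)] at h1
        simp
        rw [mul_pow, sgn_sq]
        linarith
      · simp [sgn_mul_sgn_mul]
        positivity
  rw [this]
  refine ((((convex_Iio 0).prod (convex_Ioi 0)).isConnected ⟨(-1, 1), by simp⟩).image _ ?_).image
    _ ?_
  · refine ContinuousOn.prodMk (by fun_prop) (ContinuousOn.mul (by fun_prop)
      (ContinuousOn.add ?_ (by fun_prop)))
    refine ContinuousOn.sqrt (ContinuousOn.div (by fun_prop) (by fun_prop) fun q hq => ?_)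
    have : q.1 ≠ 0 := (ne_of_lt hq.1)
    positivity
  · refine continuousOn_pi.2 fun j => ?_
    fin_cases j
    · refine ContinuousOn.div (by fun_prop) (by fun_prop) fun q hq => ?_
      obtain ⟨r, hr, rfl⟩ := hq
      have : r.1 ≠ 0 := (ne_of_lt hr.1)
      positivity
    · exact Continuous.continuousOn (by simp; fun_prop)
    · exact Continuous.continuousOn (by simp; fun_prop)

theorem not_riemComplete_cubic6_pos : ¬ RiemComplete cubic6 (locus6 ∩ {p | 0 < p 1}) := by
  refine isCubicWith_cubic6.not_riemComplete
    (U := {p | 1 < p 1 * (p 1 ^ 2 - 3 * p 2 ^ 2)} ∩ {p | 0 < p 1})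
    (σ := fun τ => ![(1 - (1 + τ) ^ 3) / ((1 + τ) ^ 2 + 0 ^ 2), 1 + τ, 0])
    (isOpen_cubic6_ineq.inter (isOpen_lt continuous_const (by fun_prop)))
    (fun p => and_assoc) (fun p hp => ?_) (fun i => ?_) (fun τ hτ => ?_) (fun h0 => ?_)
  · rw [hyperbolicLocus_cubic6]; exact hp.1
  · fin_cases i
    · refine ContDiffOn.div (by fun_prop) (by fun_prop) fun τ hτ => ?_
      have := hτ.1
      positivity
    · exact ContDiff.contDiffOn (by simp; fun_prop)
    · exact ContDiff.contDiffOn (by simp; fun_prop)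
  · have h1 : 0 < 1 + τ := by linarith [hτ.1]
    refine ⟨⟨(cubic6_eq_one_iff h1.ne').2 rfl, ?_⟩, by simpa using h1⟩
    have : 1 < (1 + τ) ^ 3 := one_lt_pow₀ (by linarith [hτ.1]) three_ne_zero
    simp
    linarith
  · have := h0.1.2
    simp at this

theorem not_riemComplete_cubic6_neg (s : Bool) :
    ¬ RiemComplete cubic6 (locus6 ∩ {p | p 1 < 0 ∧ 0 < sgn s * p 2}) := by
  have h3 : (Real.sqrt 3) ^ 2 = 3 := Real.sq_sqrt (by norm_num)
  have h30 : 0 < Real.sqrt 3 := Real.sqrt_pos.2 (by norm_num)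
  have ho1 : IsOpen {p : R3 | p 1 < 0} := isOpen_lt (by fun_prop) continuous_const
  have ho2 : IsOpen {p : R3 | 0 < sgn s * p 2} := isOpen_lt continuous_const (by fun_prop)
  refine isCubicWith_cubic6.not_riemComplete
    (U := {p | 1 < p 1 * (p 1 ^ 2 - 3 * p 2 ^ 2)} ∩ ({p | p 1 < 0} ∩ {p | 0 < sgn s * p 2}))
    (σ := fun τ => ![(1 - (-1 / 2) ^ 3) / ((-1 / 2) ^ 2 + (sgn s * (Real.sqrt 3 / 2 + τ)) ^ 2),
      -- The curve starts where y + iz is a primitive cube root of unity, so that the real part of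
      -- (y + iz)³ is 1.
      -1 / 2, sgn s * (Real.sqrt 3 / 2 + τ)])
    (isOpen_cubic6_ineq.inter (ho1.inter ho2))
    (fun p => and_assoc) (fun p hp => ?_) (fun i => ?_) (fun τ hτ => ?_) (fun h0 => ?_)
  · rw [hyperbolicLocus_cubic6]; exact hp.1
  · fin_cases i
    · refine ContDiffOn.div (by fun_prop) (by fun_prop) fun τ hτ => ?_
      positivity
    · exact ContDiff.contDiffOn (by simp; fun_prop)
    · exact ContDiff.contDiffOn (by simp; fun_prop)
  · have hτ0 := hτ.1
    refine ⟨⟨(cubic6_eq_one_iff (by norm_num)).2 rfl, ?_⟩, by simp; norm_num, ?_⟩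
    · simp [mul_pow]
      nlinarith [mul_pos h30 hτ0]
    · simp [sgn_mul_sgn_mul]
      positivity
  · have := h0.1.2
    simp [mul_pow, div_pow, h3] at this
    norm_num at this

/-! ### The cubic xz² + y³ -/

theorem isConnected_cubic7 (s : Bool) :
    IsConnected ({p | cubic7 p = 1 ∧ p 1 < 0} ∩ {p | 0 < sgn s * p 2}) := by
  have : {p | cubic7 p = 1 ∧ p 1 < 0} ∩ {p | 0 < sgn s * p 2} =
      (fun q : ℝ × ℝ => (![(1 - q.1 ^ 3) / q.2 ^ 2, q.1, sgn s * q.2] : R3)) ''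
        (Iio 0 ×ˢ Ioi 0) := by
    ext p
    simp only [mem_inter_iff, mem_ofPred_eq, mem_image, Prod.exists, mem_prod, mem_Ioi, mem_Iio]
    constructor
    · rintro ⟨⟨h, hy⟩, hz⟩
      refine ⟨p 1, sgn s * p 2, ⟨hy, hz⟩, ?_⟩
      have hz0 := right_ne_zero_of_mul hz.ne'
      simp only [cubic7] at h
      ext j; fin_cases j
      · simp [mul_pow]
        field_simp
        linarith
      · rfl
      · exact sgn_mul_sgn_mul _ _
    · rintro ⟨a, b, ⟨ha, hb⟩, rfl⟩
      refine ⟨⟨?_, by simpa using ha⟩, by simpa [sgn_mul_sgn_mul] using hb⟩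
      simp [cubic7, mul_pow]
      field_simp
      ring
  rw [this]
  refine (((convex_Iio 0).prod (convex_Ioi 0)).isConnected ⟨(-1, 1), by simp⟩).image _ ?_
  refine continuousOn_pi.2 fun j => ?_
  fin_cases j
  · refine ContinuousOn.div (by fun_prop) (by fun_prop) fun q hq => ?_
    exact pow_ne_zero _ (ne_of_gt hq.2)
  · exact Continuous.continuousOn (by simp; fun_prop)
  · exact Continuous.continuousOn (by simp; fun_prop)

theorem not_riemComplete_cubic7 (s : Bool) :
    ¬ RiemComplete cubic7 ({p | cubic7 p = 1 ∧ p 1 < 0} ∩ {p | 0 < sgn s * p 2}) := by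
  have ho1 : IsOpen {p : R3 | p 1 < 0} := isOpen_lt (by fun_prop) continuous_const
  have ho2 : IsOpen {p : R3 | 0 < sgn s * p 2} := isOpen_lt continuous_const (by fun_prop)
  refine isCubicWith_cubic7.not_riemComplete
    (U := {p | p 1 < 0} ∩ {p | 0 < sgn s * p 2})
    (σ := fun τ => ![1 + τ ^ 3, -τ, sgn s])
    (ho1.inter ho2)
    (fun p => and_assoc) (fun p hp => ?_) (fun i => ?_) (fun τ hτ => ?_) (fun h0 => ?_)
  · rw [hyperbolicLocus_cubic7]; exact hp.1
  · fin_cases i <;> exact ContDiff.contDiffOn (by simp; fun_prop)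
  · refine ⟨⟨?_, by simpa using hτ.1⟩, by simp⟩
    simp [cubic7]
    ring
  · have := h0.1.2
    simp at this

/-! ### Isomorphisms between components -/

theorem linIsomorphic_cubic1 (i j : Bool × Bool) :
    LinIsomorphic ({p | cubic1 p = 1} ∩ quadrant (fun p => p 0) (fun p => p 1) i)
      ({p | cubic1 p = 1} ∩ quadrant (fun p => p 0) (fun p => p 1) j) := by
  refine linIsomorphic_of_signChange
    -- The third sign is the product of the first two, which preserves xyz.
    ![i.1 == j.1, i.2 == j.2, (i.1 == j.1) == (i.2 == j.2)] fun p => ?_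
  obtain ⟨s, t⟩ := i
  obtain ⟨s', t'⟩ := j
  cases s <;> cases t <;> cases s' <;> cases t' <;> simp [quadrant, cubic1]

theorem linIsomorphic_cubic3 (s : Bool) :
    LinIsomorphic ({p | cubic3 p = 1 ∧ 4 * p 0 ^ 3 < 1} ∩
        quadrant (fun p => p 0) (fun p => p 1) (s, false))
      ({p | cubic3 p = 1 ∧ 4 * p 0 ^ 3 < 1} ∩
        quadrant (fun p => p 0) (fun p => p 1) (s, true)) := by
  refine linIsomorphic_of_signChange ![true, false, false] fun p => ?_
  simp [quadrant, cubic3]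

theorem linIsomorphic_cubic5 :
    LinIsomorphic (locus5 ∩ quadrant (fun p => p 1 - p 2) (fun p => p 1 + p 2) (false, true))
      (locus5 ∩ quadrant (fun p => p 1 - p 2) (fun p => p 1 + p 2) (true, false)) := by
  refine linIsomorphic_of_signChange ![true, true, false] fun p => ?_
  simp [quadrant, cubic5, locus5, ← sub_eq_add_neg]
  intro _ _ _
  rw [and_comm]

theorem linIsomorphic_cubic6 :
    LinIsomorphic (locus6 ∩ {p | p 1 < 0 ∧ 0 < sgn true * p 2})
      (locus6 ∩ {p | p 1 < 0 ∧ 0 < sgn false * p 2}) := by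
  refine linIsomorphic_of_signChange ![true, true, false] fun p => ?_
  simp [cubic6, locus6]

theorem linIsomorphic_cubic7 :
    LinIsomorphic ({p | cubic7 p = 1 ∧ p 1 < 0} ∩ {p | 0 < sgn false * p 2})
      ({p | cubic7 p = 1 ∧ p 1 < 0} ∩ {p | 0 < sgn true * p 2}) := by
  refine linIsomorphic_of_signChange ![true, true, false] fun p => ?_
  simp [cubic7]

/-! ### Lists of components and the classification -/

theorem componentsOf_cubic1 :
    componentsOf (hyperbolicLocus cubic1) = range (fun i =>
      {p | cubic1 p = 1} ∩ quadrant (fun p => p 0) (fun p => p 1) i) ∧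
    (componentsOf (hyperbolicLocus cubic1)).ncard = 4 := by
  rw [hyperbolicLocus_cubic1]
  refine componentsOf_quadrant (by fun_prop) (by fun_prop) (fun p h => ?_) isConnected_cubic1
  constructor <;> rintro e <;> simp [cubic1, e] at h

theorem componentsOf_cubic3 :
    componentsOf (hyperbolicLocus cubic3) = range (fun i =>
      {p | cubic3 p = 1 ∧ 4 * p 0 ^ 3 < 1} ∩ quadrant (fun p => p 0) (fun p => p 1) i) ∧
    (componentsOf (hyperbolicLocus cubic3)).ncard = 4 := by
  rw [hyperbolicLocus_cubic3_eq]
  refine componentsOf_quadrant (by fun_prop) (by fun_prop) (fun p h => ?_) isConnected_cubic3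
  obtain ⟨h, h3⟩ := h
  simp only [cubic3] at h
  constructor
  · rintro e; simp [e] at h
  · rintro e; simp [e] at h; linarith

theorem componentsOf_cubic5 :
    componentsOf (hyperbolicLocus cubic5) = range (fun i =>
      locus5 ∩ quadrant (fun p => p 1 - p 2) (fun p => p 1 + p 2) i) ∧
    (componentsOf (hyperbolicLocus cubic5)).ncard = 4 := by
  rw [hyperbolicLocus_cubic5]
  refine componentsOf_quadrant (by fun_prop) (by fun_prop) (fun p h => ?_) isConnected_cubic5
  have : (p 1 - p 2) * (p 1 + p 2) ≠ 0 := by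
    have := h.2.1
    contrapose! this
    linarith
  exact ⟨left_ne_zero_of_mul this, right_ne_zero_of_mul this⟩

theorem componentsOf_cubic6 :
    componentsOf (hyperbolicLocus cubic6) =
      {locus6 ∩ {p | p 1 < 0 ∧ 0 < sgn true * p 2}, locus6 ∩ {p | p 1 < 0 ∧ 0 < sgn false * p 2},
        locus6 ∩ {p | 0 < p 1}} ∧
    (componentsOf (hyperbolicLocus cubic6)).ncard = 3 := by
  have ho : ∀ s, IsOpen {p : R3 | p 1 < 0 ∧ 0 < sgn s * p 2} := fun s => by
    simp only [ofPred_and]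
    exact (isOpen_lt (by fun_prop) continuous_const).inter
      (isOpen_lt continuous_const (by fun_prop))
  have := componentsOf_eq_range (S := locus6)
    (U := fun i : Option Bool => i.elim {p | 0 < p 1} fun s => {p | p 1 < 0 ∧ 0 < sgn s * p 2})
    (A := fun i => locus6 ∩
      i.elim {p | 0 < p 1} fun s => {p | p 1 < 0 ∧ 0 < sgn s * p 2})
    (by rintro (_ | s); exacts [isConnected_cubic6_pos, isConnected_cubic6_neg s])
    (by rintro (_ | s); exacts [isOpen_lt continuous_const (by fun_prop), ho s])
    (by
      rintro (_ | s) (_ | t) hij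
      · exact absurd rfl hij
      · exact disjoint_left.2 fun p (hp : 0 < p 1) hq => lt_asymm hp hq.1
      · exact disjoint_left.2 fun p hq (hp : 0 < p 1) => lt_asymm hp hq.1
      · exact disjoint_left.2 fun p hp hq => hij (congrArg some (sgn_mul_pos_unique hp.2 hq.2)))
    (fun i => rfl)
    (by
      rintro p ⟨-, h⟩
      have hy : p 1 ≠ 0 := by rintro e; rw [e] at h; linarith
      rcases lt_or_gt_of_ne hy with hy | hy
      · have hz : p 2 ≠ 0 := by
          rintro e; rw [e] at h
          have : p 1 ^ 3 < 0 := Odd.pow_neg (by decide) hy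
          linarith
        obtain ⟨s, hs⟩ := exists_sgn_mul_pos hz
        exact ⟨some s, hy, hs⟩
      · exact ⟨none, hy⟩)
  rw [hyperbolicLocus_cubic6, ← locus6]
  refine ⟨this.1.trans ?_, by simpa using this.2⟩
  ext C
  simp only [mem_range, Option.exists, Option.elim_none, Option.elim_some, Bool.exists_bool,
    mem_insert_iff, mem_singleton_iff, eq_comm (a := C)]
  tauto

theorem componentsOf_cubic7 :
    componentsOf (hyperbolicLocus cubic7) =
      {{p | cubic7 p = 1 ∧ p 1 < 0} ∩ {p | 0 < sgn false * p 2},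
        {p | cubic7 p = 1 ∧ p 1 < 0} ∩ {p | 0 < sgn true * p 2}} ∧
    (componentsOf (hyperbolicLocus cubic7)).ncard = 2 := by
  have := componentsOf_eq_range (S := {p | cubic7 p = 1 ∧ p 1 < 0})
    (U := fun s => {p | 0 < sgn s * p 2}) isConnected_cubic7
    (fun s => isOpen_lt continuous_const (by fun_prop))
    (fun s t hst => disjoint_left.2 fun p hp hq => hst (sgn_mul_pos_unique hp hq))
    (fun s => rfl)
    (fun p ⟨h, hy⟩ => exists_sgn_mul_pos (by
      rintro e
      have : p 1 ^ 3 < 0 := Odd.pow_neg (by decide) hy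
      simp [cubic7, e] at h
      linarith))
  rw [hyperbolicLocus_cubic7]
  refine ⟨this.1.trans ?_, by simpa using this.2⟩
  ext C
  simp only [mem_range, Bool.exists_bool, mem_insert_iff, mem_singleton_iff, eq_comm (a := C)]

theorem not_riemComplete_cubic5_quadrant {i : Bool × Bool} (hi : i ≠ (false, false)) :
    ¬ RiemComplete cubic5
      (locus5 ∩ quadrant (fun p => p 1 - p 2) (fun p => p 1 + p 2) i) := by
  obtain ⟨r, hr, hr3⟩ : ∃ r : ℝ, 0 < r ∧ r ^ 3 = 3 := by
    refine ⟨(3 : ℝ) ^ ((1 : ℝ) / 3), by positivity, ?_⟩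
    rw [← Real.rpow_natCast, ← Real.rpow_mul (by norm_num)]; norm_num
  -- A boundary point with y - ez and y + ez of opposite signs; e = -1 exchanges the roles of y - z
  -- and y + z. When both are positive, f = g = 1 serves.
  have hmixed : r ^ 3 + (-1) ^ 3 = 2 := by rw [hr3]; norm_num
  obtain ⟨s, t⟩ := i
  cases s <;> cases t
  · exact absurd rfl hi
  · have := not_riemComplete_cubic5 (e := -1) (by norm_num) hr (by norm_num) hmixed
    simpa [quadrant, ← sub_eq_add_neg, and_comm] using this
  · have := not_riemComplete_cubic5 (e := 1) (by norm_num) hr (by norm_num) hmixed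
    simpa [quadrant] using this
  · have := not_riemComplete_cubic5 (e := 1) (f := 1) (g := 1) (by norm_num) one_pos one_ne_zero
      (by norm_num)
    simpa [quadrant] using this

theorem theorem4p1 :
    -- `xyz`: four mutually isomorphic components, each complete
    (hyperbolicLocus cubic1 = {p | cubic1 p = 1} ∧
      (componentsOf (hyperbolicLocus cubic1)).ncard = 4 ∧
      (∀ C ∈ componentsOf (hyperbolicLocus cubic1),
        ∀ D ∈ componentsOf (hyperbolicLocus cubic1), LinIsomorphic C D) ∧
      (∀ C ∈ componentsOf (hyperbolicLocus cubic1), RiemComplete cubic1 C)) ∧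
    -- `x(xy - z²)`: connected and complete
    (hyperbolicLocus cubic2 = {p | cubic2 p = 1 ∧ 0 < p 0} ∧
      IsConnected (hyperbolicLocus cubic2) ∧
      RiemComplete cubic2 (hyperbolicLocus cubic2)) ∧
    -- `x(yz + x²)`: two isomorphic complete and two isomorphic incomplete components
    (hyperbolicLocus cubic3 = {p | cubic3 p = 1 ∧ p 0 < 1 / (4 : ℝ) ^ ((1 : ℝ) / 3)} ∧
      (componentsOf (hyperbolicLocus cubic3)).ncard = 4 ∧
      ∃ A A' B B' : Set R3,
        componentsOf (hyperbolicLocus cubic3) = {A, A', B, B'} ∧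
        LinIsomorphic A A' ∧ RiemComplete cubic3 A ∧ RiemComplete cubic3 A' ∧
        LinIsomorphic B B' ∧ ¬ RiemComplete cubic3 B ∧ ¬ RiemComplete cubic3 B') ∧
    -- `z(x² + y² - z²)`: connected and complete
    (hyperbolicLocus cubic4 = {p | cubic4 p = 1 ∧ p 2 < 0} ∧
      IsConnected (hyperbolicLocus cubic4) ∧
      RiemComplete cubic4 (hyperbolicLocus cubic4)) ∧
    -- `x(y² - z²) + y³`: one complete component, two isomorphic incomplete ones, and a further
    -- incomplete one
    (hyperbolicLocus cubic5 =
        {p | cubic5 p = 1 ∧ p 1 ^ 2 - p 2 ^ 2 ≠ 0 ∧ p 1 * (p 1 ^ 2 + 3 * p 2 ^ 2) < 1} ∧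
      (componentsOf (hyperbolicLocus cubic5)).ncard = 4 ∧
      ∃ A B B' D : Set R3,
        componentsOf (hyperbolicLocus cubic5) = {A, B, B', D} ∧
        RiemComplete cubic5 A ∧
        LinIsomorphic B B' ∧ ¬ RiemComplete cubic5 B ∧ ¬ RiemComplete cubic5 B' ∧
        ¬ RiemComplete cubic5 D) ∧
    -- `x(y² + z²) + y³`: two isomorphic incomplete components and a further incomplete one
    (hyperbolicLocus cubic6 =
        {p | cubic6 p = 1 ∧ 1 < p 1 * (p 1 ^ 2 - 3 * p 2 ^ 2)} ∧
      (componentsOf (hyperbolicLocus cubic6)).ncard = 3 ∧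
      ∃ B B' D : Set R3,
        componentsOf (hyperbolicLocus cubic6) = {B, B', D} ∧
        LinIsomorphic B B' ∧ ¬ RiemComplete cubic6 B ∧ ¬ RiemComplete cubic6 B' ∧
        ¬ RiemComplete cubic6 D) ∧
    -- `xz² + y³`: two isomorphic incomplete components
    (hyperbolicLocus cubic7 = {p | cubic7 p = 1 ∧ p 1 < 0} ∧
      (componentsOf (hyperbolicLocus cubic7)).ncard = 2 ∧
      ∃ B B' : Set R3,
        componentsOf (hyperbolicLocus cubic7) = {B, B'} ∧
        LinIsomorphic B B' ∧ ¬ RiemComplete cubic7 B ∧ ¬ RiemComplete cubic7 B') := by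
  refine ⟨⟨hyperbolicLocus_cubic1, componentsOf_cubic1.2, ?_, ?_⟩,
    ⟨hyperbolicLocus_cubic2, ?_, ?_⟩,
    ⟨hyperbolicLocus_cubic3, componentsOf_cubic3.2, _, _, _, _,
      componentsOf_cubic3.1.trans (range_bool_prod _), linIsomorphic_cubic3 false,
      riemComplete_cubic3 false, riemComplete_cubic3 true, linIsomorphic_cubic3 true,
      not_riemComplete_cubic3 false, not_riemComplete_cubic3 true⟩,
    ⟨hyperbolicLocus_cubic4, ?_, ?_⟩,
    ⟨hyperbolicLocus_cubic5, componentsOf_cubic5.2, _, _, _, _,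
      componentsOf_cubic5.1.trans (range_bool_prod _), riemComplete_cubic5, linIsomorphic_cubic5,
      not_riemComplete_cubic5_quadrant (by decide), not_riemComplete_cubic5_quadrant (by decide),
      not_riemComplete_cubic5_quadrant (by decide)⟩,
    ⟨hyperbolicLocus_cubic6, componentsOf_cubic6.2, _, _, _, componentsOf_cubic6.1,
      linIsomorphic_cubic6, not_riemComplete_cubic6_neg true, not_riemComplete_cubic6_neg false,
      not_riemComplete_cubic6_pos⟩,
    ⟨hyperbolicLocus_cubic7, componentsOf_cubic7.2, _, _, componentsOf_cubic7.1,
      linIsomorphic_cubic7, not_riemComplete_cubic7 false, not_riemComplete_cubic7 true⟩⟩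
  · rw [componentsOf_cubic1.1]
    rintro _ ⟨i, rfl⟩ _ ⟨j, rfl⟩
    exact linIsomorphic_cubic1 i j
  · rw [componentsOf_cubic1.1]
    rintro _ ⟨i, rfl⟩
    exact riemComplete_cubic1 i
  · rw [hyperbolicLocus_cubic2]; exact isConnected_cubic2
  · rw [hyperbolicLocus_cubic2]; exact riemComplete_cubic2
  · rw [hyperbolicLocus_cubic4]; exact isConnected_cubic4
  · rw [hyperbolicLocus_cubic4]; exact riemComplete_cubic4
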